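/- Let $N\ge 1$, let $\Omega\subset\mathbb R^N$ be a bounded open set, let $1<p<\infty$, and let $a:\Omega\times\mathbb R^N\to\mathbb R^N$ satisfy, with constants $\alpha>0$, $\beta$, $c$, for a.e. $x\in\Omega$ and all $\xi,\xi_1,\xi_2,\dots\in\mathbb R^N$: (H0) $a(x,\cdot)$ is continuous for a.e. $x$, and $a(\cdot,\xi)$ is measurable for every $\xi$; (H1) $0\le (a(x,\xi_1)-a(x,\xi_2))\cdot(\xi_1-\xi_2)$; (H2) $\alpha|\xi|^p\le a(x,\xi)\cdot\xi$; (H3) $|a(x,\xi)|\le\beta|\xi|^{p-1}$; (H4) $a(x,t\xi)=t^{p-1}a(x,\xi)$ for every $t>0$; (H5) $a(x,-\xi)=-a(x,\xi)$; (H6) $|a(x,\xi_1)-a(x,\xi_2)|\le c\,\Psi(x,\xi_1,\xi_2)^{(p-1-\delta)/p}\,\big[(a(x,\xi_1)-a(x,\xi_2))\cdot(\xi_1-\xi_2)\big]^{\delta/p}$, where $\Psi(x,\xi_1,\xi_2)=a(x,\xi_1)\cdot\xi_1+a(x,\xi_2)\cdot\xi_2$ and $\delta=\min\{p/2,p-1\}$;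 (H7) $\sum_{i=1}^k a(x,\xi_i)\cdot(\xi_{i+1}-\xi_i)\le 0$ for all $k\ge1$ and $\xi_1,\dots,\xi_{k+1}$ with $\xi_{k+1}=\xi_1$; (H8) $\alpha|\xi_1-\xi_2|^\gamma\,\Psi(x,\xi_1,\xi_2)^{1-\gamma/p}\le(a(x,\xi_1)-a(x,\xi_2))\cdot(\xi_1-\xi_2)$, where $\gamma=\max\{2,p\}$ (for $\xi_1=\xi_2=0$ the left-hand side is read as $0$). Let $\rho:\Omega\to\mathbb R$ be measurable with $0<\rho^-\le\rho(x)\le\rho^+<\infty$ for a.e. $x\in\Omega$, for some constants $\rho^-,\rho^+$. Let $\Sigma$ be the set of all $\lambda\in\mathbb R$ for which the problem $$-\operatorname{div}(a(x,\nabla u))=\lambda\rho(x)|u|^{p-2}u\ \text{ in }\Omega,\qquad u=0\ \text{ on }\partial\Omega$$ has a nontrivial weak solution, i.e. for which there is $u\in W^{1,p}_0(\Omega)$, $u\ne0$, such that $$\int_\Omega a(x,\nabla u)\cdot\nabla v\,dx=\lambda\int_\Omega\rho|u|^{p-2}u\,v\,dx\qquad\text{for all }v\in W^{1,p}_0(\Omega).$$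 Then $\Sigma$ is a closed subset of $\mathbb R$, and $\Sigma\subset(0,\infty)$. -/

import Mathlib

open MeasureTheory Filter Topology
open scoped ContDiff

namespace QuasilinearEigenvalue

/-- Test functions `C_c^∞(Ω)`, extended by zero to the whole space. -/
structure IsTestFunction {N : ℕ} (Ω : Set (EuclideanSpace ℝ (Fin N)))
    (φ : EuclideanSpace ℝ (Fin N) → ℝ) : Prop where
  contDiff : ContDiff ℝ ∞ φ
  hasCompactSupport : HasCompactSupport φ
  tsupport_subset : tsupport φ ⊆ Ω

/-- `G` is the weak gradient of `u` in the open set `Ω`. -/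
structure IsWeakGradient {N : ℕ} (Ω : Set (EuclideanSpace ℝ (Fin N)))
    (u : EuclideanSpace ℝ (Fin N) → ℝ)
    (G : EuclideanSpace ℝ (Fin N) → EuclideanSpace ℝ (Fin N)) : Prop where
  locallyIntegrableOn : LocallyIntegrableOn u Ω volume
  locallyIntegrableOn_grad : LocallyIntegrableOn G Ω volume
  integral_smul_gradient : ∀ φ : EuclideanSpace ℝ (Fin N) → ℝ, IsTestFunction Ω φ →
    ∫ x in Ω, u x • gradient φ x = - ∫ x in Ω, φ x • G x

/-- `u ∈ W^{1,p}(Ω)`, with weak gradient `G`. -/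
structure MemW1p {N : ℕ} (Ω : Set (EuclideanSpace ℝ (Fin N))) (p : ℝ)
    (u : EuclideanSpace ℝ (Fin N) → ℝ)
    (G : EuclideanSpace ℝ (Fin N) → EuclideanSpace ℝ (Fin N)) : Prop where
  memLp : MemLp u (ENNReal.ofReal p) (volume.restrict Ω)
  memLp_grad : MemLp G (ENNReal.ofReal p) (volume.restrict Ω)
  isWeakGradient : IsWeakGradient Ω u G

/-- `u ∈ W_0^{1,p}(Ω)`, with weak gradient `G`: the closure of `C_c^∞(Ω)` in `W^{1,p}(Ω)`. -/
structure MemW01p {N : ℕ} (Ω : Set (EuclideanSpace ℝ (Fin N))) (p : ℝ)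
    (u : EuclideanSpace ℝ (Fin N) → ℝ)
    (G : EuclideanSpace ℝ (Fin N) → EuclideanSpace ℝ (Fin N)) : Prop where
  memW1p : MemW1p Ω p u G
  exists_approx : ∃ φ : ℕ → EuclideanSpace ℝ (Fin N) → ℝ,
    (∀ n, IsTestFunction Ω (φ n)) ∧
    Tendsto (fun n => eLpNorm (fun x => φ n x - u x) (ENNReal.ofReal p) (volume.restrict Ω))
      atTop (𝓝 0) ∧
    Tendsto (fun n => eLpNorm (fun x => gradient (φ n) x - G x) (ENNReal.ofReal p)
      (volume.restrict Ω)) atTop (𝓝 0)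

/-- `Ψ(x, ξ₁, ξ₂) = a(x, ξ₁) · ξ₁ + a(x, ξ₂) · ξ₂`. -/
noncomputable def Psi {N : ℕ}
    (a : EuclideanSpace ℝ (Fin N) → EuclideanSpace ℝ (Fin N) → EuclideanSpace ℝ (Fin N))
    (x ξ₁ ξ₂ : EuclideanSpace ℝ (Fin N)) : ℝ :=
  inner ℝ (a x ξ₁) ξ₁ + inner ℝ (a x ξ₂) ξ₂

/-- The structure conditions on the coefficient `a : Ω × ℝᴺ → ℝᴺ`, with constants
`α`, `β`, `c`. The values of `a x` for `x ∉ Ω` are irrelevant. -/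
structure StructureConditions {N : ℕ} (Ω : Set (EuclideanSpace ℝ (Fin N))) (p α β c : ℝ)
    (a : EuclideanSpace ℝ (Fin N) → EuclideanSpace ℝ (Fin N) → EuclideanSpace ℝ (Fin N)) :
    Prop where
  /-- Carathéodory condition: continuity in `ξ` -/
  continuous : ∀ᵐ x ∂(volume.restrict Ω), Continuous (a x)
  /-- Carathéodory condition: (Lebesgue) measurability in `x` -/
  aemeasurable : ∀ ξ, AEMeasurable (fun x => a x ξ) (volume.restrict Ω)
  /-- monotonicity -/
  monotone : ∀ᵐ x ∂(volume.restrict Ω), ∀ ξ₁ ξ₂,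
    0 ≤ (inner ℝ (a x ξ₁ - a x ξ₂) (ξ₁ - ξ₂) : ℝ)
  /-- coercivity -/
  coercive : ∀ᵐ x ∂(volume.restrict Ω), ∀ ξ, α * ‖ξ‖ ^ p ≤ inner ℝ (a x ξ) ξ
  /-- growth bound -/
  growth : ∀ᵐ x ∂(volume.restrict Ω), ∀ ξ, ‖a x ξ‖ ≤ β * ‖ξ‖ ^ (p - 1)
  /-- `(p - 1)`-homogeneity of `a x` -/
  homogeneous : ∀ᵐ x ∂(volume.restrict Ω), ∀ ξ, ∀ t : ℝ, 0 < t →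
    a x (t • ξ) = t ^ (p - 1) • a x ξ
  /-- oddness -/
  odd : ∀ᵐ x ∂(volume.restrict Ω), ∀ ξ, a x (-ξ) = - a x ξ
  /-- equi-continuity, with `δ = min (p / 2) (p - 1)` -/
  equicontinuous : ∀ᵐ x ∂(volume.restrict Ω), ∀ ξ₁ ξ₂,
    ‖a x ξ₁ - a x ξ₂‖ ≤ c * Psi a x ξ₁ ξ₂ ^ ((p - 1 - min (p / 2) (p - 1)) / p) *
      (inner ℝ (a x ξ₁ - a x ξ₂) (ξ₁ - ξ₂) : ℝ) ^ (min (p / 2) (p - 1) / p)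
  /-- cyclical monotonicity; the cycle is `ξ 0, …, ξ k` with `ξ k = ξ 0` -/
  cyclicallyMonotone : ∀ᵐ x ∂(volume.restrict Ω), ∀ k : ℕ, 1 ≤ k →
    ∀ ξ : ℕ → EuclideanSpace ℝ (Fin N), ξ k = ξ 0 →
      ∑ i ∈ Finset.range k, (inner ℝ (a x (ξ i)) (ξ (i + 1) - ξ i) : ℝ) ≤ 0
  /-- strict monotonicity, with `γ = max 2 p`; for `ξ₁ = ξ₂ = 0` both sides are zero -/
  strictlyMonotone : ∀ᵐ x ∂(volume.restrict Ω), ∀ ξ₁ ξ₂,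
    α * ‖ξ₁ - ξ₂‖ ^ (max 2 p) * Psi a x ξ₁ ξ₂ ^ (1 - max 2 p / p) ≤
      inner ℝ (a x ξ₁ - a x ξ₂) (ξ₁ - ξ₂)

/-- `u ∈ W_0^{1,p}(Ω)` is a weak solution of `-div a(x, ∇u) = l ρ |u|^{p-2} u` in `Ω`,
`u = 0` on `∂Ω`. -/
def IsWeakSolution {N : ℕ} (Ω : Set (EuclideanSpace ℝ (Fin N))) (p : ℝ)
    (a : EuclideanSpace ℝ (Fin N) → EuclideanSpace ℝ (Fin N) → EuclideanSpace ℝ (Fin N))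
    (ρ : EuclideanSpace ℝ (Fin N) → ℝ) (l : ℝ) (u : EuclideanSpace ℝ (Fin N) → ℝ) : Prop :=
  ∃ G, MemW01p Ω p u G ∧ ∀ v H, MemW01p Ω p v H →
    ∫ x in Ω, (inner ℝ (a x (G x)) (H x) : ℝ) =
      l * ∫ x in Ω, ρ x * (|u x| ^ (p - 2) * u x) * v x

/-- The spectrum `Σ`: all real `l` for which there is a nontrivial weak solution. -/
def spectrum {N : ℕ} (Ω : Set (EuclideanSpace ℝ (Fin N))) (p : ℝ)
    (a : EuclideanSpace ℝ (Fin N) → EuclideanSpace ℝ (Fin N) → EuclideanSpace ℝ (Fin N))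
    (ρ : EuclideanSpace ℝ (Fin N) → ℝ) : Set ℝ :=
  {l : ℝ | ∃ u, IsWeakSolution Ω p a ρ l u ∧ ¬ (u =ᵐ[volume.restrict Ω] fun _ => 0)}

end QuasilinearEigenvalue

/-! Positivity comes from testing the equation with `u` itself: the energy `∫ a(x,∇u)·∇u` equals `l
∫ ρ|u|^p`. If `l ≤ 0`, coercivity forces `∇u = 0` a.e., and the Poincaré inequality forces `u = 0`
(`IsWeakSolutionPair.pos`).

For closedness, let `l n → l'` be eigenvalues. Homogeneity allows eigenfunctions `U n` of `L^p` norm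
1. Testing with `U n` bounds the energies, hence the gradients, so Rellich's theorem yields a
subsequence converging in `L^p` (`MemW01p.exists_subseq_tendsto`). The gradients then converge
strongly as well: testing the equations of `U n` and `U m` with `U n - U m` bounds `∫ (a(x,∇U n) -
a(x,∇U m))·(∇U n - ∇U m)` by a constant times the `L^p` norm of `U n - U m`, and (H8) with Hölder
turns this into a bound for `∇U n - ∇U m` in `L^p` (`IsWeakSolutionPair.eLpNorm_grad_sub_rpow_le`).
Growth and continuity of `a x` allow passage to the limit in the weak formulation
(`IsWeakSolutionPair.of_tendsto`), and the limit has norm 1, so it is nontrivial.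

Poincaré and Rellich are both derived from one estimate, `lintegral_translation_sub_le`: a
translation by `h` moves a `C^1` function in `L^p` by at most `‖h‖` times the norm of its
derivative. -/

namespace QuasilinearEigenvalue

/-! ### Hölder and Jensen inequalities, Carathéodory functions, limits of superposition operators.
-/

section MeasureTheoryPreliminaries

variable {X : Type*} [MeasurableSpace X] {μ : Measure X}

lemma eLpNorm_ofReal_rpow {F : Type*} [NormedAddCommGroup F] {p : ℝ} (hp : 0 < p) (f : X → F) :
    eLpNorm f (ENNReal.ofReal p) μ ^ p = ∫⁻ x, ‖f x‖ₑ ^ p ∂μ := by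
  rw [eLpNorm_eq_lintegral_rpow_enorm_toReal (by simpa using hp) ENNReal.ofReal_ne_top,
    ENNReal.toReal_ofReal hp.le, ← ENNReal.rpow_mul, one_div, inv_mul_cancel₀ hp.ne',
    ENNReal.rpow_one]

lemma eLpNorm_ofReal_eq {F : Type*} [NormedAddCommGroup F] {p : ℝ} (hp : 0 < p) (f : X → F) :
    eLpNorm f (ENNReal.ofReal p) μ = (∫⁻ x, ‖f x‖ₑ ^ p ∂μ) ^ (1 / p) := by
  rw [eLpNorm_eq_lintegral_rpow_enorm_toReal (by simpa using hp) ENNReal.ofReal_ne_top,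
    ENNReal.toReal_ofReal hp.le]

/-- Jensen's inequality, as Hölder against the constant 1 with weights `1/p` and `1 - 1/p`. -/
lemma rpow_lintegral_le [IsProbabilityMeasure μ] {p : ℝ} (hp : 1 ≤ p) {f : X → ENNReal}
    (hf : AEMeasurable f μ) : (∫⁻ x, f x ∂μ) ^ p ≤ ∫⁻ x, f x ^ p ∂μ := by
  have hp0 : 0 < p := by linarith
  have h := ENNReal.lintegral_mul_norm_pow_le (μ := μ) (hf.pow_const p) (aemeasurable_const (b := 1))
    (p := 1 / p) (q := 1 - 1 / p) (by positivity)
    (sub_nonneg.2 (by rw [div_le_one hp0]; exact hp)) (by ring)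
  simp only [ENNReal.one_rpow, mul_one, lintegral_const, measure_univ] at h
  simp_rw [← ENNReal.rpow_mul, mul_one_div_cancel hp0.ne', ENNReal.rpow_one] at h
  calc _ ≤ ((∫⁻ x, f x ^ p ∂μ) ^ (1 / p)) ^ p := by gcongr
    _ = _ := by rw [← ENNReal.rpow_mul, one_div, inv_mul_cancel₀ hp0.ne', ENNReal.rpow_one]

lemma lintegral_rpow_mul_le {p : ℝ} (hp : 1 < p) {E F : Type*} [NormedAddCommGroup E]
    [NormedAddCommGroup F] {f : X → E} {g : X → F}
    (hf : AEStronglyMeasurable f μ) (hg : AEStronglyMeasurable g μ) :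
    ∫⁻ x, ‖f x‖ₑ ^ (p - 1) * ‖g x‖ₑ ∂μ ≤
      eLpNorm f (ENNReal.ofReal p) μ ^ (p - 1) * eLpNorm g (ENNReal.ofReal p) μ := by
  have hp0 : 0 < p := by linarith
  have h := ENNReal.lintegral_mul_norm_pow_le (μ := μ) (hf.enorm.pow_const p)
    (hg.enorm.pow_const p) (p := (p - 1) / p) (q := 1 / p)
    (div_nonneg (by linarith) hp0.le) (by positivity) (by field_simp; ring)
  rw [eLpNorm_ofReal_eq hp0, eLpNorm_ofReal_eq hp0, ← ENNReal.rpow_mul,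
    show 1 / p * (p - 1) = (p - 1) / p by ring]
  refine le_trans (le_of_eq ?_) h
  congr 1 with x
  rw [← ENNReal.rpow_mul, ← ENNReal.rpow_mul, mul_one_div_cancel hp0.ne', ENNReal.rpow_one,
    mul_div_cancel₀ _ hp0.ne']

lemma exists_tendsto_eLpNorm_of_cauchy {F : Type*} [NormedAddCommGroup F] [CompleteSpace F]
    {q : ENNReal} (hq : 1 ≤ q) {f : ℕ → X → F} (hf : ∀ n, MemLp (f n) q μ)
    (h : Tendsto (fun nm : ℕ × ℕ => eLpNorm (f nm.1 - f nm.2) q μ) atTop (𝓝 0)) :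
    ∃ g, MemLp g q μ ∧ Tendsto (fun n => eLpNorm (f n - g) q μ) atTop (𝓝 0) := by
  have : Fact (1 ≤ q) := ⟨hq⟩
  have hc : CauchySeq fun n => (hf n).toLp (f n) := by
    rw [Lp.cauchySeq_Lp_iff_cauchySeq_eLpNorm]
    refine h.congr fun nm => eLpNorm_congr_ae ?_
    exact ((hf nm.1).coeFn_toLp.sub (hf nm.2).coeFn_toLp).symm
  obtain ⟨g, hg⟩ := cauchySeq_tendsto_of_complete hc
  refine ⟨g, Lp.memLp g, ?_⟩
  rw [← Lp.tendsto_Lp_iff_tendsto_eLpNorm'' f hf g (Lp.memLp g)]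
  simpa using hg

/-- The value of a Carathéodory function along a measurable function is measurable. -/
lemma aestronglyMeasurable_caratheodory {E F : Type*} [NormedAddCommGroup E] [MeasurableSpace E]
    [BorelSpace E] [SecondCountableTopology E] [NormedAddCommGroup F] [MeasurableSpace F]
    [BorelSpace F] [SecondCountableTopology F] {a : X → E → F}
    (hc : ∀ᵐ x ∂μ, Continuous (a x)) (hm : ∀ ξ, AEMeasurable (fun x => a x ξ) μ)
    {G : X → E} (hG : AEStronglyMeasurable G μ) :
    AEStronglyMeasurable (fun x => a x (G x)) μ := by
  obtain ⟨G', hG', hGG'⟩ := hG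
  suffices h : AEStronglyMeasurable (fun x => a x (G' x)) μ by
    refine h.congr ?_
    filter_upwards [hGG'] with x hx
    rw [hx]
  -- Along a simple function only finitely many sections `a · ξ` occur, glued over measurable
  -- fibres; continuity in `ξ` then reaches `G'` as a pointwise limit of simple functions.
  have hs : ∀ s : SimpleFunc X E, AEMeasurable (fun x => a x (s x)) μ := by
    intro s
    have : ∀ ξ ∈ s.range, AEMeasurable (fun x => (s ⁻¹' {ξ}).indicator (fun x => a x ξ) x) μ :=
      fun ξ _ => (hm ξ).indicator (s.measurableSet_fiber ξ)
    have h2 := Finset.aemeasurable_fun_sum s.range this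
    refine h2.congr (Eventually.of_forall fun x => ?_)
    simp only
    rw [Finset.sum_eq_single (s x)]
    · simp
    · intro b _ hb
      exact Set.indicator_of_notMem (by simpa using hb.symm) _
    · intro h; exact absurd (s.mem_range_self x) h
  refine (aemeasurable_of_tendsto_metrizable_ae atTop (fun n => hs (hG'.approx n)) ?_).aestronglyMeasurable
  filter_upwards [hc] with x hx
  exact (hx.tendsto _).comp (hG'.tendsto_approx x)

lemma rpow_sub_one_mul_le {p s t : ℝ} (hp : 1 < p) (hs : 0 ≤ s) (ht : 0 ≤ t) :
    s ^ (p - 1) * t ≤ s ^ p + t ^ p := by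
  have key : ∀ r : ℝ, 0 ≤ r → r ^ (p - 1) * r = r ^ p := fun r hr => by
    rw [← Real.rpow_add_one' hr (by linarith)]; congr 1; ring
  have h1 := Real.rpow_nonneg hs p
  have h2 := Real.rpow_nonneg ht p
  rcases le_total s t with h | h
  · have : s ^ (p - 1) * t ≤ t ^ (p - 1) * t := by gcongr
    rw [key t ht] at this; linarith
  · have : s ^ (p - 1) * t ≤ s ^ (p - 1) * s := by gcongr
    rw [key s hs] at this; linarith

lemma add_rpow_le_two_rpow {p s t : ℝ} (hp : 0 ≤ p) (hs : 0 ≤ s) (ht : 0 ≤ t) :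
    (s + t) ^ p ≤ 2 ^ p * (s ^ p + t ^ p) := by
  have h1 := Real.rpow_nonneg hs p
  have h2 := Real.rpow_nonneg ht p
  have h3 : (0 : ℝ) ≤ 2 ^ p := by positivity
  rcases le_total s t with h | h
  · calc (s + t) ^ p ≤ (2 * t) ^ p := by gcongr; linarith
      _ = 2 ^ p * t ^ p := Real.mul_rpow (by norm_num) ht
      _ ≤ _ := by gcongr; linarith
  · calc (s + t) ^ p ≤ (2 * s) ^ p := by gcongr; linarith
      _ = 2 ^ p * s ^ p := Real.mul_rpow (by norm_num) hs
      _ ≤ _ := by gcongr; linarith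

lemma integrable_norm_rpow_ofReal {F : Type*} [NormedAddCommGroup F] {p : ℝ} (hp : 0 < p)
    {f : X → F} (hf : MemLp f (ENNReal.ofReal p) μ) : Integrable (fun x => ‖f x‖ ^ p) μ := by
  have := hf.integrable_norm_rpow (by simpa using hp) ENNReal.ofReal_ne_top
  rwa [ENNReal.toReal_ofReal hp.le] at this

/-- Passage to the limit in a superposition operator of order `p - 1`, tested against `L^p`. -/
lemma tendsto_integral_superposition {E W : Type*} [NormedAddCommGroup E] [NormedAddCommGroup W]
    {p : ℝ} (hp : 1 < p)
    {b : X → E → ℝ} {w : X → W} (hw : MemLp w (ENNReal.ofReal p) μ)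
    (hc : ∀ᵐ x ∂μ, Continuous (b x)) (C : ℝ)
    (hb : ∀ᵐ x ∂μ, ∀ ξ, |b x ξ| ≤ C * (‖ξ‖ ^ (p - 1) * ‖w x‖))
    {U : ℕ → X → E} {V : X → E} (hV : MemLp V (ENNReal.ofReal p) μ)
    (hU : ∀ n, MemLp (U n) (ENNReal.ofReal p) μ)
    (hbU : ∀ n, AEStronglyMeasurable (fun x => b x (U n x)) μ)
    (hbV : AEStronglyMeasurable (fun x => b x (V x)) μ)
    (hlim : Tendsto (fun n => eLpNorm (U n - V) (ENNReal.ofReal p) μ) atTop (𝓝 0))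
    (hae : ∀ᵐ x ∂μ, Tendsto (fun n => U n x) atTop (𝓝 (V x))) :
    Tendsto (fun n => ∫ x, b x (U n x) ∂μ) atTop (𝓝 (∫ x, b x (V x) ∂μ)) := by
  have hp0 : 0 < p := by linarith
  have hint : ∀ u : X → E, MemLp u (ENNReal.ofReal p) μ →
      AEStronglyMeasurable (fun x => b x (u x)) μ → Integrable (fun x => b x (u x)) μ := by
    intro u hu hbu
    refine (((integrable_norm_rpow_ofReal hp0 hu).add
      (integrable_norm_rpow_ofReal hp0 hw)).const_mul |C|).mono' hbu ?_
    filter_upwards [hb] with x hx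
    calc ‖b x (u x)‖ ≤ C * (‖u x‖ ^ (p - 1) * ‖w x‖) := hx _
      _ ≤ |C| * (‖u x‖ ^ (p - 1) * ‖w x‖) := by gcongr; exact le_abs_self C
      _ ≤ |C| * (‖u x‖ ^ p + ‖w x‖ ^ p) := by
        gcongr; exact rpow_sub_one_mul_le hp (norm_nonneg _) (norm_nonneg _)
  set K : ℝ := |C| * (2 ^ p + 2) with hK
  have hK0 : 0 ≤ K := by positivity
  set g : X → ℝ := fun x => K * (‖V x‖ ^ p + ‖w x‖ ^ p) with hg
  have hgi : Integrable g μ := ((integrable_norm_rpow_ofReal hp0 hV).add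
      (integrable_norm_rpow_ofReal hp0 hw)).const_mul K
  -- The dominating function splits into a fixed integrable `g` and a part that tends to 0 in `L^1`.
  -- In `K`, the term `2 ^ p` pays for splitting `‖U n‖^p` through `V`, and 2 covers the remaining
  -- terms in `V` and `w`.
  have hbound : ∀ n, ∀ᵐ x ∂μ, |b x (U n x) - b x (V x)| ≤ g x + K * ‖U n x - V x‖ ^ p := by
    intro n
    filter_upwards [hb] with x hx
    have h1 : ∀ ξ, |b x ξ| ≤ |C| * (‖ξ‖ ^ p + ‖w x‖ ^ p) := fun ξ => calc
      |b x ξ| ≤ C * (‖ξ‖ ^ (p - 1) * ‖w x‖) := hx _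
      _ ≤ |C| * (‖ξ‖ ^ (p - 1) * ‖w x‖) := by gcongr; exact le_abs_self C
      _ ≤ |C| * (‖ξ‖ ^ p + ‖w x‖ ^ p) := by
        gcongr; exact rpow_sub_one_mul_le hp (norm_nonneg _) (norm_nonneg _)
    have h2 : ‖U n x‖ ^ p ≤ 2 ^ p * (‖U n x - V x‖ ^ p + ‖V x‖ ^ p) := by
      refine le_trans ?_ (add_rpow_le_two_rpow hp0.le (norm_nonneg _) (norm_nonneg _))
      gcongr
      simpa using norm_add_le (U n x - V x) (V x)
    have h3 : (0 : ℝ) < 2 ^ p := by positivity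
    have h4 : 0 ≤ ‖V x‖ ^ p := by positivity
    have h5 : 0 ≤ ‖w x‖ ^ p := by positivity
    have h6 : 0 ≤ ‖U n x - V x‖ ^ p := by positivity
    calc |b x (U n x) - b x (V x)| ≤ |b x (U n x)| + |b x (V x)| := abs_sub _ _
      _ ≤ |C| * (‖U n x‖ ^ p + ‖w x‖ ^ p) + |C| * (‖V x‖ ^ p + ‖w x‖ ^ p) :=
        add_le_add (h1 _) (h1 _)
      _ = |C| * (‖U n x‖ ^ p + ‖V x‖ ^ p + 2 * ‖w x‖ ^ p) := by ring
      _ ≤ |C| * ((2 ^ p + 2) * (‖V x‖ ^ p + ‖w x‖ ^ p + ‖U n x - V x‖ ^ p)) := by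
        gcongr; nlinarith [mul_nonneg h3.le h5]
      _ = _ := by simp only [hg, hK]; ring
  refine tendsto_integral_of_L1 _ hbV (Eventually.of_forall fun n => hint _ (hU n) (hbU n)) ?_
  have hsmall : Tendsto (fun n => ∫⁻ x, ENNReal.ofReal (K * ‖U n x - V x‖ ^ p) ∂μ) atTop (𝓝 0) := by
    have h1 : ∀ n, ∫⁻ x, ENNReal.ofReal (K * ‖U n x - V x‖ ^ p) ∂μ
        = ENNReal.ofReal K * eLpNorm (U n - V) (ENNReal.ofReal p) μ ^ p := by
      intro n
      rw [eLpNorm_ofReal_rpow hp0, ← lintegral_const_mul' _ _ ENNReal.ofReal_ne_top]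
      congr 1 with x
      rw [ENNReal.ofReal_mul hK0, ← ENNReal.ofReal_rpow_of_nonneg (norm_nonneg _) hp0.le,
        ofReal_norm, Pi.sub_apply]
    simp_rw [h1]
    have h3 := (ENNReal.continuous_rpow_const (y := p)).tendsto 0
    rw [ENNReal.zero_rpow_of_pos hp0] at h3
    have h4 := ENNReal.Tendsto.const_mul (a := ENNReal.ofReal K) (h3.comp hlim)
      (Or.inr ENNReal.ofReal_ne_top)
    simpa using h4
  -- Truncating the difference at `g` makes ordinary dominated convergence applicable; the excess
  -- over `g` is at most the term of `hsmall`.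
  have hmin : Tendsto (fun n => ∫⁻ x, ENNReal.ofReal (min |b x (U n x) - b x (V x)| (g x)) ∂μ)
      atTop (𝓝 0) := by
    rw [← lintegral_zero (μ := μ)]
    refine tendsto_lintegral_of_dominated_convergence' (fun x => ENNReal.ofReal (g x)) ?_ ?_ ?_ ?_
    · intro n
      exact ((((hbU n).sub hbV).norm.aemeasurable).min hgi.aemeasurable).ennreal_ofReal
    · exact fun n => Eventually.of_forall fun x => ENNReal.ofReal_le_ofReal (min_le_right _ _)
    · exact hgi.lintegral_lt_top.ne
    · filter_upwards [hae, hc] with x hx hcx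
      have h1 : Tendsto (fun n => |b x (U n x) - b x (V x)|) atTop (𝓝 0) := by
        have := (((hcx.tendsto _).comp hx).sub_const (b x (V x))).abs
        simpa using this
      have h2 : Tendsto (fun n => min |b x (U n x) - b x (V x)| (g x)) atTop (𝓝 (min 0 (g x))) :=
        h1.min tendsto_const_nhds
      rw [min_eq_left (by positivity)] at h2
      simpa using ENNReal.tendsto_ofReal h2
  have hsum := hmin.add hsmall
  rw [add_zero] at hsum
  refine tendsto_of_tendsto_of_tendsto_of_le_of_le tendsto_const_nhds hsum
    (fun _ => zero_le) fun n => ?_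
  rw [← lintegral_add_left']
  · refine lintegral_mono_ae ?_
    filter_upwards [hbound n] with x hx
    have hgx : 0 ≤ g x := by positivity
    have hh : 0 ≤ K * ‖U n x - V x‖ ^ p := by positivity
    rw [← ofReal_norm, Real.norm_eq_abs, ← ENNReal.ofReal_add (by positivity) hh]
    refine ENNReal.ofReal_le_ofReal ?_
    rcases le_total |b x (U n x) - b x (V x)| (g x) with h | h
    · rw [min_eq_left h]; linarith
    · rw [min_eq_right h]; exact hx
  · exact ((((hbU n).sub hbV).norm.aemeasurable).min hgi.aemeasurable).ennreal_ofReal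

end MeasureTheoryPreliminaries
end QuasilinearEigenvalue

namespace QuasilinearEigenvalue

/-! ### The translation estimate and the Poincaré inequality. -/

section Translation

variable {E : Type*} [NormedAddCommGroup E] [NormedSpace ℝ E]

lemma enorm_sub_le_lintegral_fderiv {φ : E → ℝ} (hφ : ContDiff ℝ 1 φ) (x h : E) :
    ‖φ (x + h) - φ x‖ₑ ≤ ∫⁻ t in Set.Ioc (0 : ℝ) 1, ‖h‖ₑ * ‖fderiv ℝ φ (x + t • h)‖ₑ := by
  have hd : ∀ t ∈ Set.uIcc (0 : ℝ) 1,
      HasDerivAt (fun t : ℝ => φ (x + t • h)) (fderiv ℝ φ (x + t • h) h) t := by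
    intro t _
    have h1 : HasDerivAt (fun t : ℝ => x + t • h) h t := by
      simpa using ((hasDerivAt_id t).smul_const h).const_add x
    exact ((hφ.differentiable one_ne_zero) _).hasFDerivAt.comp_hasDerivAt t h1
  have hcont : Continuous fun t : ℝ => fderiv ℝ φ (x + t • h) h :=
    ((hφ.continuous_fderiv one_ne_zero).comp (by fun_prop)).clm_apply continuous_const
  have hi := intervalIntegral.integral_eq_sub_of_hasDerivAt hd (hcont.intervalIntegrable 0 1)
  simp only [one_smul, zero_smul, add_zero] at hi
  rw [← hi, intervalIntegral.integral_of_le zero_le_one]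
  refine (enorm_integral_le_lintegral_enorm _).trans (lintegral_mono fun t => ?_)
  rw [mul_comm]
  exact ContinuousLinearMap.le_opENorm _ _

variable [MeasurableSpace E] [BorelSpace E]

/-- The increment is an integral of the derivative along the segment. Jensen in `t` and Tonelli
leave inner integrals that, by translation invariance, do not depend on `t`. -/
lemma lintegral_translation_sub_le [SecondCountableTopology E] (μ : Measure E) [SFinite μ]
    [μ.IsAddRightInvariant] {p : ℝ} (hp : 1 ≤ p)
    {φ : E → ℝ} (hφ : ContDiff ℝ 1 φ) (h : E) :
    ∫⁻ x, ‖φ (x + h) - φ x‖ₑ ^ p ∂μ ≤ ‖h‖ₑ ^ p * ∫⁻ x, ‖fderiv ℝ φ x‖ₑ ^ p ∂μ := by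
  have hp0 : 0 ≤ p := by linarith
  have hcont : Continuous fun z : E × ℝ => fderiv ℝ φ (z.1 + z.2 • h) :=
    (hφ.continuous_fderiv one_ne_zero).comp (by fun_prop)
  have : IsProbabilityMeasure (volume.restrict (Set.Ioc (0 : ℝ) 1)) := ⟨by simp⟩
  calc ∫⁻ x, ‖φ (x + h) - φ x‖ₑ ^ p ∂μ
      ≤ ∫⁻ x, ∫⁻ t in Set.Ioc (0 : ℝ) 1, (‖h‖ₑ * ‖fderiv ℝ φ (x + t • h)‖ₑ) ^ p ∂volume ∂μ := by
        refine lintegral_mono fun x => ?_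
        refine (ENNReal.rpow_le_rpow (enorm_sub_le_lintegral_fderiv hφ x h) hp0).trans ?_
        refine rpow_lintegral_le hp (Continuous.aemeasurable ?_)
        exact (ENNReal.continuous_const_mul enorm_ne_top).comp
          ((hcont.comp (by fun_prop : Continuous fun t : ℝ => (x, t))).enorm)
    _ = ∫⁻ x, ∫⁻ t in Set.Ioc (0 : ℝ) 1, ‖h‖ₑ ^ p * ‖fderiv ℝ φ (x + t • h)‖ₑ ^ p ∂volume ∂μ := by
        simp_rw [ENNReal.mul_rpow_of_nonneg _ _ hp0]
    _ = ∫⁻ t in Set.Ioc (0 : ℝ) 1, ∫⁻ x, ‖h‖ₑ ^ p * ‖fderiv ℝ φ (x + t • h)‖ₑ ^ p ∂μ := by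
        refine lintegral_lintegral_swap (Measurable.aemeasurable ?_)
        exact (hcont.measurable.enorm.pow_const p).const_mul _
    _ = ∫⁻ t in Set.Ioc (0 : ℝ) 1, ‖h‖ₑ ^ p * ∫⁻ x, ‖fderiv ℝ φ x‖ₑ ^ p ∂μ := by
        refine lintegral_congr fun t => ?_
        rw [lintegral_const_mul' _ _ (ENNReal.rpow_ne_top_of_nonneg hp0 enorm_ne_top),
          lintegral_add_right_eq_self (fun x => ‖fderiv ℝ φ x‖ₑ ^ p) (t • h)]
    _ = _ := by simp

/-- Poincaré inequality for functions with support in a bounded set. -/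
lemma lintegral_le_mul_lintegral_fderiv [SecondCountableTopology E] [Nontrivial E]
    (μ : Measure E) [SFinite μ]
    [μ.IsAddRightInvariant] {Ω : Set E} (hΩ : Bornology.IsBounded Ω) {p : ℝ} (hp : 1 ≤ p) :
    ∃ C : ENNReal, C ≠ ⊤ ∧ ∀ φ : E → ℝ, ContDiff ℝ 1 φ → Function.support φ ⊆ Ω →
      ∫⁻ x in Ω, ‖φ x‖ₑ ^ p ∂μ ≤ C * ∫⁻ x, ‖fderiv ℝ φ x‖ₑ ^ p ∂μ := by
  obtain ⟨R, hR⟩ := hΩ.subset_ball 0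
  -- A vector longer than the diameter of the ball carries every point of `Ω` out of `Ω`. There `φ
  -- (x + h) = 0`, so the translation estimate bounds `φ` itself, with constant `‖h‖^p`.
  obtain ⟨h, hh⟩ := NormedSpace.exists_lt_norm ℝ E (2 * R)
  refine ⟨‖h‖ₑ ^ p, ENNReal.rpow_ne_top_of_nonneg (by linarith) enorm_ne_top, fun φ hφ hs => ?_⟩
  refine le_trans ?_ (lintegral_translation_sub_le μ hp hφ h)
  rw [setLIntegral_eq_of_support_subset]
  · refine lintegral_mono fun x => ?_
    by_cases hx : x ∈ Ω
    · have : φ (x + h) = 0 := by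
        by_contra hne
        have h1 := hR (hs hne)
        have h2 := hR hx
        rw [mem_ball_zero_iff] at h1 h2
        have h3 := norm_sub_le (x + h) x
        rw [add_sub_cancel_left] at h3
        linarith
      simp [this]
    · have : φ x = 0 := by
        by_contra hne
        exact hx (hs hne)
      simp [this, show 0 < p by linarith]
  · intro x hx
    refine hs fun h0 => hx ?_
    simp [h0, show 0 < p by linarith]

end Translation

section Rounding

variable {E : Type*} [PseudoMetricSpace E] [MeasurableSpace E] [OpensMeasurableSpace E]
  [TopologicalSpace.SeparableSpace E] [Nonempty E]

/-- Measurable choice of a point of a fixed countable dense set at distance less than `δ`. -/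
lemma exists_measurable_dist_denseSeq_lt {δ : ℝ} (hδ : 0 < δ) :
    ∃ j : E → ℕ, Measurable j ∧ ∀ x, dist x (TopologicalSpace.denseSeq E (j x)) < δ := by
  classical
  have h : ∀ x : E, ∃ n, dist x (TopologicalSpace.denseSeq E n) < δ := fun x =>
    (TopologicalSpace.denseRange_denseSeq E).exists_dist_lt x hδ
  exact ⟨fun x => Nat.find (h x), measurable_find h fun k => measurableSet_ball,
    fun x => Nat.find_spec (h x)⟩

end Rounding

/-! ### Rellich compactness through averages over small balls. -/

section StepApproximation

variable {E : Type*} [NormedAddCommGroup E] [NormedSpace ℝ E] [MeasurableSpace E] [BorelSpace E]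
  [FiniteDimensional ℝ E] (μ : Measure E) [μ.IsAddHaarMeasure]

/-- Jensen for normalised measure on the ball. The bound does not depend on the centre, so at a
fixed scale all averages of an `L^p`-bounded sequence lie in one compact interval. -/
lemma enorm_average_ball_le {p : ℝ} (hp : 1 ≤ p) {φ : E → ℝ} (hφ : Continuous φ)
    {δ : ℝ} (hδ : 0 < δ) (z : E) :
    ‖⨍ y in Metric.ball z δ, φ y ∂μ‖ₑ ≤
      ((μ (Metric.ball (0 : E) δ))⁻¹ * ∫⁻ x, ‖φ x‖ₑ ^ p ∂μ) ^ (1 / p) := by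
  have hp0 : 0 < p := by linarith
  set m := μ (Metric.ball (0 : E) δ) with hm
  have hm0 : m ≠ 0 := (Metric.measure_ball_pos μ 0 hδ).ne'
  have hmt : m ≠ ⊤ := measure_ball_lt_top.ne
  set ν := (μ.restrict (Metric.ball z δ) Set.univ)⁻¹ • μ.restrict (Metric.ball z δ) with hν
  have hνu : μ.restrict (Metric.ball z δ) Set.univ = m := by
    rw [Measure.restrict_apply_univ, Measure.addHaar_ball_center]
  have hνp : IsProbabilityMeasure ν := by
    refine ⟨?_⟩
    rw [hν, Measure.smul_apply, hνu, smul_eq_mul, ENNReal.inv_mul_cancel hm0 hmt]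
  rw [one_div, ENNReal.le_rpow_inv_iff hp0]
  calc ‖∫ y, φ y ∂ν‖ₑ ^ p ≤ (∫⁻ y, ‖φ y‖ₑ ∂ν) ^ p := by
        gcongr; exact enorm_integral_le_lintegral_enorm _
    _ ≤ ∫⁻ y, ‖φ y‖ₑ ^ p ∂ν := rpow_lintegral_le hp hφ.measurable.enorm.aemeasurable
    _ = m⁻¹ * ∫⁻ y in Metric.ball z δ, ‖φ y‖ₑ ^ p ∂μ := by
        rw [hν, lintegral_smul_measure, hνu, smul_eq_mul]
    _ ≤ _ := by gcongr; exact Measure.restrict_le_self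

variable [Nontrivial E]

/-- Averages over balls of radius `δ` whose centres are at distance less than `δ` approximate
`φ` in `L^p` with an error controlled by the gradient. -/
lemma lintegral_sub_average_le {p : ℝ} (hp : 1 ≤ p) {φ : E → ℝ} (hφ : ContDiff ℝ 1 φ)
    {δ : ℝ} (hδ : 0 < δ) {g : E → E} (hg : ∀ x, dist x (g x) < δ) :
    ∫⁻ x, ‖φ x - ⨍ y in Metric.ball (g x) δ, φ y ∂μ‖ₑ ^ p ∂μ ≤
      ENNReal.ofReal (2 ^ Module.finrank ℝ E) * (ENNReal.ofReal (2 * δ) ^ p *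
        ∫⁻ x, ‖fderiv ℝ φ x‖ₑ ^ p ∂μ) := by
  have hp0 : 0 ≤ p := by linarith
  set m := μ (Metric.ball (0 : E) δ) with hm
  have hm0 : m ≠ 0 := (Metric.measure_ball_pos μ 0 hδ).ne'
  have hmt : m ≠ ⊤ := measure_ball_lt_top.ne
  have hball : ∀ z : E, μ (Metric.ball z δ) = m := fun z => Measure.addHaar_ball_center μ z δ
  have h2 : μ (Metric.ball (0 : E) (2 * δ)) = ENNReal.ofReal (2 ^ Module.finrank ℝ E) * m := by
    rw [hm, Measure.addHaar_ball μ 0 (by positivity), Measure.addHaar_ball μ 0 hδ.le, mul_pow,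
      ENNReal.ofReal_mul (by positivity), mul_assoc]
  -- The ball of radius `δ` about `g x` lies in the ball of radius `2δ` about `x`, so after Jensen
  -- only increments shorter than `2δ` matter. Enlarging the ball costs the volume ratio `2 ^
  -- finrank` from `h2`.
  have hpt : ∀ x, ‖φ x - ⨍ y in Metric.ball (g x) δ, φ y ∂μ‖ₑ ^ p ≤
      m⁻¹ * ∫⁻ h in Metric.ball (0 : E) (2 * δ), ‖φ (x + h) - φ x‖ₑ ^ p ∂μ := by
    intro x
    set ν := (μ.restrict (Metric.ball (g x) δ) Set.univ)⁻¹ • μ.restrict (Metric.ball (g x) δ)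
      with hν
    have hνu : μ.restrict (Metric.ball (g x) δ) Set.univ = m := by
      rw [Measure.restrict_apply_univ, hball]
    have hνp : IsProbabilityMeasure ν := by
      refine ⟨?_⟩
      rw [hν, Measure.smul_apply, hνu, smul_eq_mul, ENNReal.inv_mul_cancel hm0 hmt]
    have hi : Integrable φ ν := by
      refine Integrable.smul_measure ?_ (by rw [hνu]; simpa using hm0)
      exact (hφ.continuous.locallyIntegrable.integrableOn_isCompact
        (isCompact_closedBall (g x) δ)).mono_set Metric.ball_subset_closedBall
    have h1 : φ x - ⨍ y in Metric.ball (g x) δ, φ y ∂μ = ∫ y, (φ x - φ y) ∂ν := by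
      rw [integral_sub (integrable_const _) hi, integral_const, probReal_univ, one_smul]
      rfl
    rw [h1]
    calc ‖∫ y, (φ x - φ y) ∂ν‖ₑ ^ p ≤ (∫⁻ y, ‖φ x - φ y‖ₑ ∂ν) ^ p := by
          gcongr; exact enorm_integral_le_lintegral_enorm _
      _ ≤ ∫⁻ y, ‖φ x - φ y‖ₑ ^ p ∂ν :=
          rpow_lintegral_le hp (continuous_const.sub hφ.continuous).measurable.enorm.aemeasurable
      _ = m⁻¹ * ∫⁻ y in Metric.ball (g x) δ, ‖φ x - φ y‖ₑ ^ p ∂μ := by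
          rw [hν, lintegral_smul_measure, hνu, smul_eq_mul]
      _ ≤ m⁻¹ * ∫⁻ y in Metric.ball x (2 * δ), ‖φ x - φ y‖ₑ ^ p ∂μ := by
          gcongr
          refine Metric.ball_subset_ball' ?_
          have := hg x
          rw [dist_comm] at this
          linarith
      _ = m⁻¹ * ∫⁻ h in Metric.ball (0 : E) (2 * δ), ‖φ (x + h) - φ x‖ₑ ^ p ∂μ := by
          congr 1
          rw [← lintegral_indicator measurableSet_ball, ← lintegral_indicator measurableSet_ball,
            ← lintegral_add_left_eq_self _ x]
          refine lintegral_congr fun h => ?_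
          simp only [Set.indicator, Metric.mem_ball, dist_self_add_left, dist_zero_right]
          rw [← enorm_neg, neg_sub]
  calc ∫⁻ x, ‖φ x - ⨍ y in Metric.ball (g x) δ, φ y ∂μ‖ₑ ^ p ∂μ
      ≤ ∫⁻ x, m⁻¹ * ∫⁻ h in Metric.ball (0 : E) (2 * δ), ‖φ (x + h) - φ x‖ₑ ^ p ∂μ ∂μ :=
        lintegral_mono hpt
    _ = m⁻¹ * ∫⁻ h in Metric.ball (0 : E) (2 * δ), ∫⁻ x, ‖φ (x + h) - φ x‖ₑ ^ p ∂μ ∂μ := by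
        rw [lintegral_const_mul' _ _ (ENNReal.inv_ne_top.2 hm0), lintegral_lintegral_swap]
        refine Measurable.aemeasurable (Measurable.pow_const (Measurable.enorm ?_) p)
        have := hφ.continuous
        exact Continuous.measurable (by fun_prop)
    _ ≤ m⁻¹ * ∫⁻ h in Metric.ball (0 : E) (2 * δ), ENNReal.ofReal (2 * δ) ^ p *
          ∫⁻ x, ‖fderiv ℝ φ x‖ₑ ^ p ∂μ ∂μ := by
        gcongr m⁻¹ * ?_
        refine setLIntegral_mono' measurableSet_ball fun h hh => ?_
        refine (lintegral_translation_sub_le μ hp hφ h).trans ?_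
        gcongr
        rw [← ofReal_norm]
        exact ENNReal.ofReal_le_ofReal (mem_ball_zero_iff.1 hh).le
    _ = _ := by
        rw [setLIntegral_const, h2]
        rw [mul_comm (ENNReal.ofReal (2 ^ _)) m, ← mul_assoc _ m, mul_comm _ m, ← mul_assoc,
          ← mul_assoc, ENNReal.inv_mul_cancel hm0 hmt]
        ring

/-- Rellich compactness: a sequence of smooth functions with bounded `W^{1,p}` norm has a
subsequence which is Cauchy in `L^p` of every given set of finite measure. -/
lemma exists_subseq_cauchy_eLpNorm {p : ℝ} (hp : 1 ≤ p) {Ω : Set E} (hΩ : μ Ω ≠ ⊤)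
    {φ : ℕ → E → ℝ} (hφ : ∀ n, ContDiff ℝ 1 (φ n)) {M : ENNReal} (hM : M ≠ ⊤)
    (hφM : ∀ n, ∫⁻ x, ‖φ n x‖ₑ ^ p ∂μ ≤ M) (hφM' : ∀ n, ∫⁻ x, ‖fderiv ℝ (φ n) x‖ₑ ^ p ∂μ ≤ M) :
    ∃ s : ℕ → ℕ, StrictMono s ∧ Tendsto (fun nm : ℕ × ℕ =>
      eLpNorm (φ (s nm.1) - φ (s nm.2)) (ENNReal.ofReal p) (μ.restrict Ω)) atTop (𝓝 0) := by
  have hp0 : 0 < p := by linarith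
  have hp1 : 1 ≤ ENNReal.ofReal p := by simpa using hp
  have : IsFiniteMeasure (μ.restrict Ω) := ⟨by simpa using hΩ.lt_top⟩
  set δ : ℕ → ℝ := fun k => 1 / ((k : ℝ) + 1) with hδ
  have hδ0 : ∀ k, 0 < δ k := fun k => by positivity
  choose j hj hjd using fun k => exists_measurable_dist_denseSeq_lt (E := E) (hδ0 k)
  -- The pair `k` encodes a scale and a centre from the countable dense set.
  set A : ℕ → ℕ × ℕ → ℝ := fun n k =>
    ⨍ y in Metric.ball (TopologicalSpace.denseSeq E k.2) (δ k.1), φ n y ∂μ with hA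
  set B : ℕ → ENNReal := fun k => ((μ (Metric.ball (0 : E) (δ k)))⁻¹ * M) ^ (1 / p) with hB
  have hBt : ∀ k, B k ≠ ⊤ := fun k => ENNReal.rpow_ne_top_of_nonneg (by positivity)
    (ENNReal.mul_ne_top (ENNReal.inv_ne_top.2 (Metric.measure_ball_pos μ 0 (hδ0 k)).ne') hM)
  have hAB : ∀ n k, ‖A n k‖ₑ ≤ B k.1 := fun n k =>
    (enorm_average_ball_le μ hp (hφ n).continuous (hδ0 k.1) _).trans (by
      simp only [hB]; gcongr; exact hφM n)
  -- Tychonoff with a countable index set replaces the diagonal argument: one subsequence makes the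
  -- averages converge for all scales and centres.
  obtain ⟨L, hLB, s, hs, hsL⟩ := (isCompact_univ_pi fun k : ℕ × ℕ =>
    isCompact_Icc (a := -(B k.1).toReal) (b := (B k.1).toReal)).tendsto_subseq
    (x := A) (fun n k _ => by
      rw [Set.mem_Icc, ← abs_le, ← Real.norm_eq_abs, ← toReal_enorm]
      exact ENNReal.toReal_mono (hBt _) (hAB n k))
  rw [tendsto_pi_nhds] at hsL
  refine ⟨s, hs, ?_⟩
  -- At a fixed scale the step functions converge pointwise and are uniformly bounded, and `Ω` has
  -- finite measure.
  have hstep : ∀ k, Tendsto (fun n => eLpNorm (fun x => A (s n) (k, j k x) - L (k, j k x))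
      (ENNReal.ofReal p) (μ.restrict Ω)) atTop (𝓝 0) := by
    intro k
    have h1 : Tendsto (fun n => ∫⁻ x in Ω, ‖A (s n) (k, j k x) - L (k, j k x)‖ₑ ^ p ∂μ)
        atTop (𝓝 (∫⁻ x in Ω, 0 ∂μ)) := by
      refine tendsto_lintegral_of_dominated_convergence
        (fun _ => (B k + B k) ^ p) ?_ ?_ ?_ ?_
      · intro n
        exact ((((measurable_from_top (f := fun i => A (s n) (k, i))).comp (hj k)).sub
          ((measurable_from_top (f := fun i => L (k, i))).comp (hj k))).enorm).pow_const p
      · intro n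
        refine Eventually.of_forall fun x => ?_
        refine ENNReal.rpow_le_rpow (enorm_sub_le.trans (add_le_add (hAB _ _) ?_)) hp0.le
        have h2 := hLB (k, j k x) (Set.mem_univ _)
        simp only [Set.mem_Icc] at h2
        rw [← abs_le] at h2
        rw [← ofReal_norm, Real.norm_eq_abs]
        exact ENNReal.ofReal_le_of_le_toReal h2
      · rw [lintegral_const]
        exact ENNReal.mul_ne_top (ENNReal.rpow_ne_top_of_nonneg hp0.le
          (ENNReal.add_ne_top.2 ⟨hBt k, hBt k⟩)) (measure_ne_top _ _)
      · refine Eventually.of_forall fun x => ?_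
        have h2 := ((hsL (k, j k x)).sub_const (L (k, j k x))).enorm
        have h3 := ((ENNReal.continuous_rpow_const (y := p)).tendsto _).comp h2
        simpa [hp0, Function.comp_def] using h3
    rw [lintegral_zero] at h1
    have h2 := ((ENNReal.continuous_rpow_const (y := 1 / p)).tendsto _).comp h1
    rw [ENNReal.zero_rpow_of_pos (by positivity)] at h2
    refine h2.congr fun n => ?_
    rw [eLpNorm_ofReal_eq hp0]; rfl
  -- The error of replacing `φ n` by its step function: uniform in `n`, and vanishing as the scale
  -- shrinks.
  set e : ℕ → ENNReal := fun k => (ENNReal.ofReal (2 ^ Module.finrank ℝ E) *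
    (ENNReal.ofReal (2 * δ k) ^ p * M)) ^ (1 / p) with he
  have happrox : ∀ k n, eLpNorm (fun x => φ n x - A n (k, j k x)) (ENNReal.ofReal p)
      (μ.restrict Ω) ≤ e k := by
    intro k n
    rw [eLpNorm_ofReal_eq hp0]
    refine ENNReal.rpow_le_rpow ?_ (by positivity)
    refine (lintegral_mono' Measure.restrict_le_self le_rfl).trans ?_
    refine (lintegral_sub_average_le μ hp (hφ n) (hδ0 k)
      (g := fun x => TopologicalSpace.denseSeq E (j k x)) (hjd k)).trans ?_
    gcongr
    exact hφM' n
  have he0 : Tendsto e atTop (𝓝 0) := by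
    have h1 : Tendsto (fun k => ENNReal.ofReal (2 * δ k)) atTop (𝓝 0) := by
      have := ENNReal.tendsto_ofReal ((tendsto_one_div_add_atTop_nhds_zero_nat (𝕜 := ℝ)).const_mul 2)
      rwa [mul_zero, ENNReal.ofReal_zero] at this
    have h2 := ((ENNReal.continuous_rpow_const (y := p)).tendsto _).comp h1
    rw [ENNReal.zero_rpow_of_pos hp0] at h2
    have h3 := ENNReal.Tendsto.const_mul (a := ENNReal.ofReal (2 ^ Module.finrank ℝ E))
      (ENNReal.Tendsto.mul_const h2 (Or.inr hM)) (Or.inr ENNReal.ofReal_ne_top)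
    have h4 := ((ENNReal.continuous_rpow_const (y := 1 / p)).tendsto _).comp h3
    rw [zero_mul, mul_zero, ENNReal.zero_rpow_of_pos (by positivity)] at h4
    exact h4
  have hAm : ∀ k n, AEStronglyMeasurable (fun x => A n (k, j k x)) (μ.restrict Ω) := fun k n =>
    ((measurable_from_top (f := fun i => A n (k, i))).comp (hj k)).aestronglyMeasurable
  have hLm : ∀ k, AEStronglyMeasurable (fun x => L (k, j k x)) (μ.restrict Ω) := fun k =>
    ((measurable_from_top (f := fun i => L (k, i))).comp (hj k)).aestronglyMeasurable
  have hφm : ∀ n, AEStronglyMeasurable (φ n) (μ.restrict Ω) := fun n =>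
    (hφ n).continuous.aestronglyMeasurable
  have htri : ∀ k n, eLpNorm (fun x => φ (s n) x - L (k, j k x)) (ENNReal.ofReal p)
      (μ.restrict Ω) ≤ e k + eLpNorm (fun x => A (s n) (k, j k x) - L (k, j k x))
      (ENNReal.ofReal p) (μ.restrict Ω) := by
    intro k n
    refine le_trans ?_ (add_le_add_left (happrox k (s n)) _)
    refine le_trans (le_of_eq ?_) (eLpNorm_add_le ((hφm _).sub (hAm k _)) ((hAm k _).sub (hLm k))
      hp1)
    congr 1 with x
    simp
  rw [ENNReal.tendsto_nhds_zero]
  intro ε hε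
  have hε4 : 0 < ε / 2 / 2 := ENNReal.half_pos (ENNReal.half_pos hε.ne').ne'
  obtain ⟨k, hk⟩ := ((ENNReal.tendsto_nhds_zero.1 he0) (ε / 2 / 2) hε4).exists
  have hev : ∀ᶠ n in atTop, eLpNorm (fun x => φ (s n) x - L (k, j k x)) (ENNReal.ofReal p)
      (μ.restrict Ω) ≤ ε / 2 := by
    filter_upwards [(ENNReal.tendsto_nhds_zero.1 (hstep k)) (ε / 2 / 2) hε4] with n hn
    refine (htri k n).trans ((add_le_add hk hn).trans (ENNReal.add_halves _).le)
  rw [← prod_atTop_atTop_eq]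
  filter_upwards [hev.prod_mk hev] with nm h
  calc _ ≤ eLpNorm (fun x => φ (s nm.1) x - L (k, j k x)) (ENNReal.ofReal p) (μ.restrict Ω) +
        eLpNorm (fun x => φ (s nm.2) x - L (k, j k x)) (ENNReal.ofReal p) (μ.restrict Ω) := by
        refine le_trans (le_of_eq ?_) (eLpNorm_sub_le ((hφm _).sub (hLm k))
          ((hφm _).sub (hLm k)) hp1)
        congr 1 with x
        simp
    _ ≤ ε / 2 + ε / 2 := add_le_add h.1 h.2
    _ = ε := ENNReal.add_halves ε

end StepApproximation
end QuasilinearEigenvalue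

namespace QuasilinearEigenvalue

/-! ### Limits of integrals, and elementary facts on test functions. -/

section Limits

variable {X : Type*} [MeasurableSpace X] {μ : Measure X}

lemma tendsto_eLpNorm_one {F : Type*} [NormedAddCommGroup F] [IsFiniteMeasure μ] {q : ENNReal}
    (hq : 1 ≤ q) {f : ℕ → X → F} (hf : ∀ n, AEStronglyMeasurable (f n) μ)
    (h : Tendsto (fun n => eLpNorm (f n) q μ) atTop (𝓝 0)) :
    Tendsto (fun n => eLpNorm (f n) 1 μ) atTop (𝓝 0) := by
  have h1 := ENNReal.Tendsto.mul_const
    (b := μ Set.univ ^ (1 / (1 : ENNReal).toReal - 1 / q.toReal)) h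
    (Or.inr (ENNReal.rpow_ne_top_of_nonneg ?_ (measure_ne_top _ _)))
  · rw [zero_mul] at h1
    exact tendsto_of_tendsto_of_tendsto_of_le_of_le tendsto_const_nhds h1 (fun _ => zero_le)
      fun n => eLpNorm_le_eLpNorm_mul_rpow_measure_univ hq (hf n)
  · rw [ENNReal.toReal_one, one_div_one, sub_nonneg]
    rcases eq_or_ne q ⊤ with rfl | hqt
    · simp
    · have : 1 ≤ q.toReal := by simpa using ENNReal.toReal_mono hqt hq
      rw [div_le_one (by linarith)]
      exact this

/-- Serves to pass to the limit in the identity defining the weak gradient, whose two sides are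
linear in the function and in its gradient, with bounded coefficients. -/
lemma tendsto_integral_of_lipschitz {F F' : Type*} [NormedAddCommGroup F] [NormedAddCommGroup F']
    [NormedSpace ℝ F'] [IsFiniteMeasure μ] {q : ENNReal} (hq : 1 ≤ q) {f : ℕ → X → F} {g : X → F}
    (hf : ∀ n, AEStronglyMeasurable (f n) μ) (hg : AEStronglyMeasurable g μ)
    (hlim : Tendsto (fun n => eLpNorm (f n - g) q μ) atTop (𝓝 0))
    {h : X → F → F'} {C : ℝ} (hC : ∀ x a b, ‖h x a - h x b‖ ≤ C * ‖a - b‖)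
    (hi : ∀ n, Integrable (fun x => h x (f n x)) μ) (hig : Integrable (fun x => h x (g x)) μ) :
    Tendsto (fun n => ∫ x, h x (f n x) ∂μ) atTop (𝓝 (∫ x, h x (g x) ∂μ)) := by
  refine tendsto_integral_of_L1 _ hig.aestronglyMeasurable (Eventually.of_forall hi) ?_
  have h1 := ENNReal.Tendsto.const_mul (a := ENNReal.ofReal C)
    (tendsto_eLpNorm_one hq (fun n => (hf n).sub hg) hlim) (Or.inr ENNReal.ofReal_ne_top)
  rw [mul_zero] at h1
  refine tendsto_of_tendsto_of_tendsto_of_le_of_le tendsto_const_nhds h1 (fun _ => zero_le)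
      fun n => ?_
  simp only [eLpNorm_one_eq_lintegral_enorm]
  rw [← lintegral_const_mul' _ _ ENNReal.ofReal_ne_top]
  refine lintegral_mono fun x => ?_
  rw [← ofReal_norm, ← ofReal_norm, Pi.sub_apply, ← ENNReal.ofReal_mul' (norm_nonneg _)]
  exact ENNReal.ofReal_le_ofReal (hC x _ _)

end Limits

variable {N : ℕ} {Ω : Set (EuclideanSpace ℝ (Fin N))} {p : ℝ}
  {φ ψ : EuclideanSpace ℝ (Fin N) → ℝ}
  {u v : EuclideanSpace ℝ (Fin N) → ℝ}
  {G H : EuclideanSpace ℝ (Fin N) → EuclideanSpace ℝ (Fin N)}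

namespace IsTestFunction

lemma contDiff_one (hφ : IsTestFunction Ω φ) : ContDiff ℝ 1 φ := hφ.contDiff.of_le (by simp)

lemma differentiableAt (hφ : IsTestFunction Ω φ) (x) : DifferentiableAt ℝ φ x :=
  hφ.contDiff_one.differentiable one_ne_zero x

lemma continuous_gradient (hφ : IsTestFunction Ω φ) : Continuous (gradient φ) :=
  (InnerProductSpace.toDual ℝ _).symm.continuous.comp
    (hφ.contDiff_one.continuous_fderiv one_ne_zero)

lemma enorm_gradient (φ : EuclideanSpace ℝ (Fin N) → ℝ) (x) :
    ‖gradient φ x‖ₑ = ‖fderiv ℝ φ x‖ₑ := by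
  rw [← ofReal_norm, ← ofReal_norm, gradient, LinearIsometryEquiv.norm_map]

lemma exists_bound (hφ : IsTestFunction Ω φ) : ∃ C, ∀ x, ‖φ x‖ ≤ C :=
  hφ.hasCompactSupport.exists_bound_of_continuous hφ.contDiff.continuous

lemma exists_bound_gradient (hφ : IsTestFunction Ω φ) : ∃ C, ∀ x, ‖gradient φ x‖ ≤ C := by
  obtain ⟨C, hC⟩ := (hφ.hasCompactSupport.fderiv (𝕜 := ℝ)).exists_bound_of_continuous
    (hφ.contDiff_one.continuous_fderiv one_ne_zero)
  exact ⟨C, fun x => by rw [gradient, LinearIsometryEquiv.norm_map]; exact hC x⟩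

lemma support_subset (hφ : IsTestFunction Ω φ) : Function.support φ ⊆ Ω :=
  (subset_tsupport φ).trans hφ.tsupport_subset

lemma lintegral_eq (hφ : IsTestFunction Ω φ) (hp : 0 < p) :
    ∫⁻ x in Ω, ‖φ x‖ₑ ^ p = ∫⁻ x, ‖φ x‖ₑ ^ p := by
  refine setLIntegral_eq_of_support_subset fun x hx => hφ.support_subset fun h0 => hx ?_
  simp [h0, hp]

lemma lintegral_gradient_eq (hφ : IsTestFunction Ω φ) (hp : 0 < p) :
    ∫⁻ x in Ω, ‖gradient φ x‖ₑ ^ p = ∫⁻ x, ‖fderiv ℝ φ x‖ₑ ^ p := by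
  simp_rw [enorm_gradient]
  refine setLIntegral_eq_of_support_subset fun x hx => hφ.tsupport_subset ?_
  refine (tsupport_fderiv_subset ℝ) (subset_tsupport _ fun h0 => hx ?_)
  have h1 : ‖fderiv ℝ φ x‖ₑ = 0 := by rw [← ofReal_norm, h0, norm_zero, ENNReal.ofReal_zero]
  simp only [h1, ENNReal.zero_rpow_of_pos hp]

lemma linearCombination (hφ : IsTestFunction Ω φ) (hψ : IsTestFunction Ω ψ) (c d : ℝ) :
    IsTestFunction Ω (fun x => c * φ x + d * ψ x) where
  contDiff := (contDiff_const.mul hφ.contDiff).add (contDiff_const.mul hψ.contDiff)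
  hasCompactSupport := (hφ.hasCompactSupport.mul_left).add (hψ.hasCompactSupport.mul_left)
  tsupport_subset := by
    refine (tsupport_add _ _).trans (Set.union_subset ?_ ?_)
    · exact (tsupport_mul_subset_right).trans hφ.tsupport_subset
    · exact (tsupport_mul_subset_right).trans hψ.tsupport_subset

lemma gradient_linearCombination (hφ : IsTestFunction Ω φ) (hψ : IsTestFunction Ω ψ) (c d : ℝ)
    (x) : gradient (fun x => c * φ x + d * ψ x) x = c • gradient φ x + d • gradient ψ x := by
  have h1 : HasFDerivAt (fun x => c * φ x + d * ψ x)
      (c • fderiv ℝ φ x + d • fderiv ℝ ψ x) x :=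
    ((hφ.differentiableAt x).hasFDerivAt.const_mul c).add
      ((hψ.differentiableAt x).hasFDerivAt.const_mul d)
  rw [gradient, h1.fderiv, map_add, map_smulₛₗ, map_smulₛₗ]
  rfl

end IsTestFunction

lemma integrable_smul_gradient [IsFiniteMeasure (volume.restrict Ω)] (hp : 1 ≤ p)
    (hu : MemLp u (ENNReal.ofReal p) (volume.restrict Ω)) (hφ : IsTestFunction Ω φ) :
    Integrable (fun x => u x • gradient φ x) (volume.restrict Ω) := by
  obtain ⟨C, hC⟩ := hφ.exists_bound_gradient
  exact (hu.integrable (by simpa using hp)).smul_bdd C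
    hφ.continuous_gradient.aestronglyMeasurable (Eventually.of_forall hC)

lemma integrable_smul_of_testFunction [IsFiniteMeasure (volume.restrict Ω)] (hp : 1 ≤ p)
    (hG : MemLp G (ENNReal.ofReal p) (volume.restrict Ω)) (hφ : IsTestFunction Ω φ) :
    Integrable (fun x => φ x • G x) (volume.restrict Ω) := by
  obtain ⟨C, hC⟩ := hφ.exists_bound
  exact (hG.integrable (by simpa using hp)).bdd_smul C
    hφ.contDiff.continuous.aestronglyMeasurable (Eventually.of_forall hC)

/-! ### The space `W_0^{1,p}`: linearity, closedness, Poincaré, Rellich. -/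

namespace MemW01p

lemma linearCombination [IsFiniteMeasure (volume.restrict Ω)] (hp : 1 ≤ p)
    (hu : MemW01p Ω p u G) (hv : MemW01p Ω p v H)
    (c d : ℝ) : MemW01p Ω p (fun x => c * u x + d * v x) (fun x => c • G x + d • H x) := by
  have hp1 : 1 ≤ ENNReal.ofReal p := by simpa using hp
  have hmu := hu.memW1p.memLp
  have hmv := hv.memW1p.memLp
  have hmG := hu.memW1p.memLp_grad
  have hmH := hv.memW1p.memLp_grad
  have h1 : MemLp (fun x => c * u x + d * v x) (ENNReal.ofReal p) (volume.restrict Ω) :=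
    (hmu.const_mul c).add (hmv.const_mul d)
  have h2 : MemLp (fun x => c • G x + d • H x) (ENNReal.ofReal p) (volume.restrict Ω) :=
    (hmG.const_smul c).add (hmH.const_smul d)
  refine ⟨⟨h1, h2, ?_, ?_, ?_⟩, ?_⟩
  · exact IntegrableOn.locallyIntegrableOn (h1.integrable hp1)
  · exact IntegrableOn.locallyIntegrableOn (h2.integrable hp1)
  · intro φ hφ
    have e1 := hu.memW1p.isWeakGradient.integral_smul_gradient φ hφ
    have e2 := hv.memW1p.isWeakGradient.integral_smul_gradient φ hφ
    have i1 := integrable_smul_gradient hp hmu hφ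
    have i2 := integrable_smul_gradient hp hmv hφ
    have i3 := integrable_smul_of_testFunction hp hmG hφ
    have i4 := integrable_smul_of_testFunction hp hmH hφ
    calc ∫ x in Ω, (c * u x + d * v x) • gradient φ x
        = ∫ x in Ω, (c • (u x • gradient φ x) + d • (v x • gradient φ x)) := by
          congr 1 with x : 1; rw [add_smul, mul_smul, mul_smul]
      _ = - (c • ∫ x in Ω, φ x • G x) + - (d • ∫ x in Ω, φ x • H x) := by
          rw [integral_add (i1.fun_smul c) (i2.fun_smul d), integral_smul, integral_smul, e1, e2,
            smul_neg, smul_neg]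
      _ = - ∫ x in Ω, (c • (φ x • G x) + d • (φ x • H x)) := by
          rw [integral_add (i3.fun_smul c) (i4.fun_smul d), integral_smul, integral_smul, neg_add]
      _ = - ∫ x in Ω, φ x • (c • G x + d • H x) := by
          congr 2 with x : 1
          rw [smul_add, smul_comm, smul_comm (φ x) d]
  · obtain ⟨f, hf, hfu, hfG⟩ := hu.exists_approx
    obtain ⟨g, hg, hgv, hgH⟩ := hv.exists_approx
    refine ⟨fun n x => c * f n x + d * g n x, fun n => (hf n).linearCombination (hg n) c d, ?_, ?_⟩
    · have h := (ENNReal.Tendsto.const_mul (a := ‖c‖ₑ) hfu (Or.inr enorm_ne_top)).add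
        (ENNReal.Tendsto.const_mul (a := ‖d‖ₑ) hgv (Or.inr enorm_ne_top))
      rw [mul_zero, mul_zero, add_zero] at h
      refine tendsto_of_tendsto_of_tendsto_of_le_of_le tendsto_const_nhds h
        (fun _ => zero_le) fun n => ?_
      dsimp only
      rw [← eLpNorm_const_smul, ← eLpNorm_const_smul]
      refine le_trans (le_of_eq ?_) (eLpNorm_add_le ?_ ?_ hp1)
      · congr 1 with x
        simp only [Pi.add_apply, Pi.smul_apply, smul_eq_mul]
        ring
      · exact (((hf n).contDiff.continuous.aestronglyMeasurable).sub
          hmu.aestronglyMeasurable).const_smul c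
      · exact (((hg n).contDiff.continuous.aestronglyMeasurable).sub
          hmv.aestronglyMeasurable).const_smul d
    · have h := (ENNReal.Tendsto.const_mul (a := ‖c‖ₑ) hfG (Or.inr enorm_ne_top)).add
        (ENNReal.Tendsto.const_mul (a := ‖d‖ₑ) hgH (Or.inr enorm_ne_top))
      rw [mul_zero, mul_zero, add_zero] at h
      refine tendsto_of_tendsto_of_tendsto_of_le_of_le tendsto_const_nhds h
        (fun _ => zero_le) fun n => ?_
      dsimp only
      rw [← eLpNorm_const_smul, ← eLpNorm_const_smul]
      refine le_trans (le_of_eq ?_) (eLpNorm_add_le ?_ ?_ hp1)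
      · congr 1 with x : 1
        simp only [Pi.add_apply, Pi.smul_apply, (hf n).gradient_linearCombination (hg n)]
        module
      · exact (((hf n).continuous_gradient.aestronglyMeasurable).sub
          hmG.aestronglyMeasurable).const_smul c
      · exact (((hg n).continuous_gradient.aestronglyMeasurable).sub
          hmH.aestronglyMeasurable).const_smul d

lemma exists_testFunction_near (hu : MemW01p Ω p u G) {ε : ENNReal} (hε : 0 < ε) :
    ∃ φ, IsTestFunction Ω φ ∧
      eLpNorm (φ - u) (ENNReal.ofReal p) (volume.restrict Ω) ≤ ε ∧
      eLpNorm (gradient φ - G) (ENNReal.ofReal p) (volume.restrict Ω) ≤ ε := by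
  obtain ⟨f, hf, hfu, hfG⟩ := hu.exists_approx
  obtain ⟨n, h1, h2⟩ := ((ENNReal.tendsto_nhds_zero.1 hfu ε hε).and
    (ENNReal.tendsto_nhds_zero.1 hfG ε hε)).exists
  exact ⟨f n, hf n, h1, h2⟩

lemma of_tendsto [IsFiniteMeasure (volume.restrict Ω)] (hp : 1 ≤ p)
    {U : ℕ → EuclideanSpace ℝ (Fin N) → ℝ}
    {K : ℕ → EuclideanSpace ℝ (Fin N) → EuclideanSpace ℝ (Fin N)}
    (hU : ∀ n, MemW01p Ω p (U n) (K n))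
    (hu : MemLp u (ENNReal.ofReal p) (volume.restrict Ω))
    (hG : MemLp G (ENNReal.ofReal p) (volume.restrict Ω))
    (hUu : Tendsto (fun n => eLpNorm (U n - u) (ENNReal.ofReal p) (volume.restrict Ω))
      atTop (𝓝 0))
    (hKG : Tendsto (fun n => eLpNorm (K n - G) (ENNReal.ofReal p) (volume.restrict Ω))
      atTop (𝓝 0)) : MemW01p Ω p u G := by
  have hp1 : 1 ≤ ENNReal.ofReal p := by simpa using hp
  refine ⟨⟨hu, hG, ?_, ?_, ?_⟩, ?_⟩
  · exact IntegrableOn.locallyIntegrableOn (hu.integrable hp1)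
  · exact IntegrableOn.locallyIntegrableOn (hG.integrable hp1)
  · intro φ hφ
    obtain ⟨C, hC⟩ := hφ.exists_bound_gradient
    obtain ⟨D, hD⟩ := hφ.exists_bound
    have h1 := tendsto_integral_of_lipschitz hp1
      (fun n => (hU n).memW1p.memLp.aestronglyMeasurable) hu.aestronglyMeasurable hUu
      (h := fun x a => a • gradient φ x) (C := C)
      (fun x a b => by rw [← sub_smul, norm_smul, mul_comm]; gcongr; exact hC x)
      (fun n => integrable_smul_gradient hp (hU n).memW1p.memLp hφ)
      (integrable_smul_gradient hp hu hφ)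
    have h2 := tendsto_integral_of_lipschitz hp1
      (fun n => (hU n).memW1p.memLp_grad.aestronglyMeasurable) hG.aestronglyMeasurable hKG
      (h := fun x a => φ x • a) (C := D)
      (fun x a b => by rw [← smul_sub, norm_smul]; gcongr; exact hD x)
      (fun n => integrable_smul_of_testFunction hp (hU n).memW1p.memLp_grad hφ)
      (integrable_smul_of_testFunction hp hG hφ)
    refine tendsto_nhds_unique (h1.congr fun n => ?_) h2.neg
    exact (hU n).memW1p.isWeakGradient.integral_smul_gradient φ hφ
  -- Diagonal choice: a test function within `1/n` of `U n`. For `n = 0` the tolerance is `⊤`, so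
  -- nothing is required.
  · have hε : ∀ n : ℕ, (0 : ENNReal) < (n : ENNReal)⁻¹ := fun n => by simp
    choose f hf hfU hfK using fun n => (hU n).exists_testFunction_near (hε n)
    refine ⟨f, hf, ?_, ?_⟩
    · have h := ENNReal.tendsto_inv_nat_nhds_zero.add hUu
      rw [add_zero] at h
      refine tendsto_of_tendsto_of_tendsto_of_le_of_le tendsto_const_nhds h
        (fun _ => zero_le) fun n => ?_
      refine le_trans ?_ (add_le_add_left (hfU n) _)
      refine le_trans (le_of_eq ?_) (eLpNorm_add_le
        ((hf n).contDiff.continuous.aestronglyMeasurable.sub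
          (hU n).memW1p.memLp.aestronglyMeasurable)
        ((hU n).memW1p.memLp.aestronglyMeasurable.sub hu.aestronglyMeasurable) hp1)
      congr 1 with x
      simp
    · have h := ENNReal.tendsto_inv_nat_nhds_zero.add hKG
      rw [add_zero] at h
      refine tendsto_of_tendsto_of_tendsto_of_le_of_le tendsto_const_nhds h
        (fun _ => zero_le) fun n => ?_
      refine le_trans ?_ (add_le_add_left (hfK n) _)
      refine le_trans (le_of_eq ?_) (eLpNorm_add_le
        ((hf n).continuous_gradient.aestronglyMeasurable.sub
          (hU n).memW1p.memLp_grad.aestronglyMeasurable)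
        ((hU n).memW1p.memLp_grad.aestronglyMeasurable.sub hG.aestronglyMeasurable) hp1)
      congr 1 with x : 1
      simp

/-- The approximating test functions have gradients tending to 0, so by Poincaré they tend to 0
themselves, while also tending to `u`. -/
lemma ae_eq_zero_of_grad (hN : 1 ≤ N) (hΩ : Bornology.IsBounded Ω) (hp : 1 ≤ p)
    (hu : MemW01p Ω p u G) (hG : G =ᵐ[volume.restrict Ω] 0) :
    u =ᵐ[volume.restrict Ω] fun _ => 0 := by
  have hp0 : 0 < p := by linarith
  have hp1 : 1 ≤ ENNReal.ofReal p := by simpa using hp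
  have : Nonempty (Fin N) := ⟨⟨0, hN⟩⟩
  obtain ⟨C, hC, hPoin⟩ := lintegral_le_mul_lintegral_fderiv
    (volume : Measure (EuclideanSpace ℝ (Fin N))) hΩ hp
  obtain ⟨f, hf, hfu, hfG⟩ := hu.exists_approx
  have h1 : ∀ n, eLpNorm (f n) (ENNReal.ofReal p) (volume.restrict Ω) ≤
      C ^ (1 / p) * eLpNorm (fun x => gradient (f n) x - G x) (ENNReal.ofReal p)
        (volume.restrict Ω) := by
    intro n
    have h2 : eLpNorm (fun x => gradient (f n) x - G x) (ENNReal.ofReal p)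
        (volume.restrict Ω) = eLpNorm (gradient (f n)) (ENNReal.ofReal p) (volume.restrict Ω) := by
      refine eLpNorm_congr_ae ?_
      filter_upwards [hG] with x hx
      simp [hx]
    rw [h2, eLpNorm_ofReal_eq hp0, eLpNorm_ofReal_eq hp0, ← ENNReal.mul_rpow_of_nonneg _ _
      (by positivity), (hf n).lintegral_gradient_eq hp0]
    exact ENNReal.rpow_le_rpow (hPoin _ (hf n).contDiff_one (hf n).support_subset) (by positivity)
  have h3 := (ENNReal.Tendsto.const_mul (a := C ^ (1 / p)) hfG
    (Or.inr (ENNReal.rpow_ne_top_of_nonneg (by positivity) hC))).add hfu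
  rw [mul_zero, zero_add] at h3
  have h4 : eLpNorm u (ENNReal.ofReal p) (volume.restrict Ω) ≤ 0 := by
    refine ge_of_tendsto' h3 fun n => ?_
    refine le_trans ?_ (add_le_add_left (h1 n) _)
    refine le_trans (le_of_eq ?_) (eLpNorm_sub_le
      ((hf n).contDiff.continuous.aestronglyMeasurable)
      ((hf n).contDiff.continuous.aestronglyMeasurable.sub
        hu.memW1p.memLp.aestronglyMeasurable) hp1)
    congr 1 with x
    simp
  exact (eLpNorm_eq_zero_iff hu.memW1p.memLp.aestronglyMeasurable (by simpa using hp0)).1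
    (le_antisymm h4 zero_le)

/-- Rellich–Kondrachov compactness of `W_0^{1,p}(Ω) → L^p(Ω)`. -/
lemma exists_subseq_tendsto (hN : 1 ≤ N) [IsFiniteMeasure (volume.restrict Ω)] (hp : 1 ≤ p)
    {U : ℕ → EuclideanSpace ℝ (Fin N) → ℝ}
    {K : ℕ → EuclideanSpace ℝ (Fin N) → EuclideanSpace ℝ (Fin N)}
    (hU : ∀ n, MemW01p Ω p (U n) (K n)) {M : ENNReal} (hM : M ≠ ⊤)
    (hUM : ∀ n, eLpNorm (U n) (ENNReal.ofReal p) (volume.restrict Ω) ≤ M)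
    (hKM : ∀ n, eLpNorm (K n) (ENNReal.ofReal p) (volume.restrict Ω) ≤ M) :
    ∃ s : ℕ → ℕ, StrictMono s ∧ ∃ u, MemLp u (ENNReal.ofReal p) (volume.restrict Ω) ∧
      Tendsto (fun n => eLpNorm (U (s n) - u) (ENNReal.ofReal p) (volume.restrict Ω))
        atTop (𝓝 0) := by
  have hp0 : 0 < p := by linarith
  have hp1 : 1 ≤ ENNReal.ofReal p := by simpa using hp
  have : Nonempty (Fin N) := ⟨⟨0, hN⟩⟩
  have hε : ∀ n : ℕ, (0 : ENNReal) < ((n : ENNReal) + 1)⁻¹ := fun n => by simp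
  have hε1 : ∀ n : ℕ, ((n : ENNReal) + 1)⁻¹ ≤ 1 := fun n => by simp
  -- Rellich is available for smooth functions. Tolerances `1/(n+1) ≤ 1` keep the norms below `1 +
  -- M` and preserve the limit.
  choose f hf hfU hfK using fun n => (hU n).exists_testFunction_near (hε n)
  have hUm := fun n => (hU n).memW1p.memLp.aestronglyMeasurable
  have hKm := fun n => (hU n).memW1p.memLp_grad.aestronglyMeasurable
  have hfm : ∀ n, AEStronglyMeasurable (f n) (volume.restrict Ω) :=
    fun n => (hf n).contDiff.continuous.aestronglyMeasurable
  have hgm : ∀ n, AEStronglyMeasurable (gradient (f n)) (volume.restrict Ω) :=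
    fun n => (hf n).continuous_gradient.aestronglyMeasurable
  have hΩ : volume Ω ≠ ⊤ := by
    have := measure_ne_top (volume.restrict Ω) Set.univ
    rwa [Measure.restrict_apply_univ] at this
  obtain ⟨s, hs, hsc⟩ := exists_subseq_cauchy_eLpNorm volume hp hΩ
    (fun n => (hf n).contDiff_one) (M := (1 + M) ^ p)
    (ENNReal.rpow_ne_top_of_nonneg hp0.le (ENNReal.add_ne_top.2 ⟨ENNReal.one_ne_top, hM⟩))
    (fun n => by
      rw [← (hf n).lintegral_eq hp0, ← eLpNorm_ofReal_rpow hp0]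
      gcongr
      refine le_trans ?_ (add_le_add ((hfU n).trans (hε1 n)) (hUM n))
      refine le_trans (le_of_eq ?_) (eLpNorm_add_le ((hfm n).sub (hUm n)) (hUm n) hp1)
      simp)
    (fun n => by
      rw [← (hf n).lintegral_gradient_eq hp0, ← eLpNorm_ofReal_rpow hp0]
      gcongr
      refine le_trans ?_ (add_le_add ((hfK n).trans (hε1 n)) (hKM n))
      refine le_trans (le_of_eq ?_) (eLpNorm_add_le ((hgm n).sub (hKm n)) (hKm n) hp1)
      simp)
  have hfL : ∀ n, MemLp (f n) (ENNReal.ofReal p) (volume.restrict Ω) := fun n => by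
    obtain ⟨C, hC⟩ := (hf n).exists_bound
    exact MemLp.of_bound (hfm n) C (Eventually.of_forall hC)
  obtain ⟨u, hu, hfu⟩ := exists_tendsto_eLpNorm_of_cauchy hp1 (fun n => hfL (s n)) hsc
  refine ⟨s, hs, u, hu, ?_⟩
  have h0 : Tendsto (fun n : ℕ => ((n : ENNReal) + 1)⁻¹) atTop (𝓝 0) := by
    have := ENNReal.tendsto_inv_nat_nhds_zero.comp (tendsto_add_atTop_nat 1)
    refine this.congr fun n => ?_
    simp
  have h := (h0.comp hs.tendsto_atTop).add hfu
  rw [add_zero] at h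
  refine tendsto_of_tendsto_of_tendsto_of_le_of_le tendsto_const_nhds h
    (fun _ => zero_le) fun n => ?_
  refine le_trans ?_ (add_le_add_left (hfU (s n)) _)
  rw [eLpNorm_sub_comm (f (s n))]
  refine le_trans (le_of_eq ?_) (eLpNorm_add_le ((hUm _).sub (hfm _))
    ((hfm _).sub hu.aestronglyMeasurable) hp1)
  congr 1 with x
  simp

end MemW01p
end QuasilinearEigenvalue

/-! ### Pointwise inequalities and energy estimates for weak solutions. -/

namespace QuasilinearEigenvalue

section Pointwise

lemma abs_abs_rpow_mul_self {p : ℝ} (hp : 1 < p) (t : ℝ) :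
    |(|t| ^ (p - 2) * t)| = |t| ^ (p - 1) := by
  rcases eq_or_ne t 0 with rfl | ht
  · rw [mul_zero, abs_zero, Real.zero_rpow (by linarith)]
  · have h : 0 < |t| := abs_pos.2 ht
    rw [abs_mul, abs_of_nonneg (by positivity)]
    nth_rw 2 [← Real.rpow_one |t|]
    rw [← Real.rpow_add h]
    congr 1; ring

/-- Only `t = 0` is delicate: for `p < 2` the first factor is singular there, but the product has
modulus `|t|^(p-1)`, and `p > 1`. -/
lemma continuous_abs_rpow_mul_self {p : ℝ} (hp : 1 < p) :
    Continuous fun t : ℝ => |t| ^ (p - 2) * t := by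
  rw [continuous_iff_continuousAt]
  intro t
  rcases eq_or_ne t 0 with rfl | ht
  · rw [ContinuousAt, mul_zero, tendsto_zero_iff_abs_tendsto_zero]
    have h : Continuous fun t : ℝ => |t| ^ (p - 1) :=
      continuous_abs.rpow_const fun _ => Or.inr (by linarith)
    have h0 := h.tendsto 0
    rw [abs_zero, Real.zero_rpow (by linarith)] at h0
    exact h0.congr fun t => (abs_abs_rpow_mul_self hp t).symm
  · exact (continuousAt_id.abs.rpow_const (Or.inl (abs_ne_zero.2 ht))).mul continuousAt_id

lemma abs_mul_rpow_mul_self {p c : ℝ} (hc : 0 < c) (t : ℝ) :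
    |c * t| ^ (p - 2) * (c * t) = c ^ (p - 1) * (|t| ^ (p - 2) * t) := by
  rw [abs_mul, abs_of_pos hc, Real.mul_rpow hc.le (abs_nonneg t)]
  have : c ^ (p - 1) = c ^ (p - 2) * c := by
    nth_rw 3 [← Real.rpow_one c]
    rw [← Real.rpow_add hc]; congr 1; ring
  rw [this]; ring

/-- (H8) solved for `d^p`, in a form ready for Hölder with weights `θ = p / max 2 p` and `1 - θ`.
For `p ≥ 2` the weight of `S` is zero. -/
lemma rpow_le_of_strict_monotone {p α d S D : ℝ} (hp : 1 < p) (hα : 0 < α) (hd : 0 ≤ d)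
    (hS : 0 ≤ S) (hS0 : S = 0 → d = 0) (hD : 0 ≤ D)
    (h : α * d ^ (max 2 p) * S ^ (1 - max 2 p / p) ≤ D) :
    d ^ p ≤ (D / α) ^ (p / max 2 p) * S ^ (1 - p / max 2 p) := by
  set γ := max 2 p with hγ
  have hγ0 : 0 < γ := lt_of_lt_of_le two_pos (le_max_left _ _)
  have hp0 : 0 < p := by linarith
  -- If `S = 0` and `p < 2`, the negative power of 0 in `h` evaluates to 0 and `h` says nothing;
  -- `hS0` settles this case.
  rcases hS.eq_or_lt with h0 | hpos
  · rw [hS0 h0.symm, Real.zero_rpow hp0.ne']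
    positivity
  · have h1 : d ^ γ ≤ D / α * S ^ (γ / p - 1) := by
      rw [show γ / p - 1 = -(1 - γ / p) by ring, Real.rpow_neg hS, ← div_eq_mul_inv,
        le_div_iff₀ (by positivity), le_div_iff₀ hα]
      linarith
    calc d ^ p = (d ^ γ) ^ (p / γ) := by
          rw [← Real.rpow_mul hd, mul_div_cancel₀ _ hγ0.ne']
      _ ≤ (D / α * S ^ (γ / p - 1)) ^ (p / γ) := by gcongr
      _ = _ := by
          rw [Real.mul_rpow (by positivity) (by positivity), ← Real.rpow_mul hS]
          congr 2
          field_simp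

end Pointwise

variable {N : ℕ} {Ω : Set (EuclideanSpace ℝ (Fin N))} {p α β c R : ℝ}
  {a : EuclideanSpace ℝ (Fin N) → EuclideanSpace ℝ (Fin N) → EuclideanSpace ℝ (Fin N)}
  {ρ : EuclideanSpace ℝ (Fin N) → ℝ}
  {u v : EuclideanSpace ℝ (Fin N) → ℝ}
  {G H : EuclideanSpace ℝ (Fin N) → EuclideanSpace ℝ (Fin N)}

namespace StructureConditions

lemma aestronglyMeasurable_comp (ha : StructureConditions Ω p α β c a)
    (hG : AEStronglyMeasurable G (volume.restrict Ω)) :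
    AEStronglyMeasurable (fun x => a x (G x)) (volume.restrict Ω) :=
  aestronglyMeasurable_caratheodory ha.continuous ha.aemeasurable hG

lemma abs_inner_le (ha : StructureConditions Ω p α β c a)
    (H : EuclideanSpace ℝ (Fin N) → EuclideanSpace ℝ (Fin N)) :
    ∀ᵐ x ∂(volume.restrict Ω), ∀ ξ,
      |(inner ℝ (a x ξ) (H x) : ℝ)| ≤ β * (‖ξ‖ ^ (p - 1) * ‖H x‖) := by
  filter_upwards [ha.growth] with x hx ξ
  calc |(inner ℝ (a x ξ) (H x) : ℝ)| ≤ ‖a x ξ‖ * ‖H x‖ := abs_real_inner_le_norm _ _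
    _ ≤ β * ‖ξ‖ ^ (p - 1) * ‖H x‖ := by gcongr; exact hx ξ
    _ = _ := by ring

lemma integrable_inner (ha : StructureConditions Ω p α β c a) (hp : 1 < p)
    (hG : MemLp G (ENNReal.ofReal p) (volume.restrict Ω))
    (hH : MemLp H (ENNReal.ofReal p) (volume.restrict Ω)) :
    Integrable (fun x => (inner ℝ (a x (G x)) (H x) : ℝ)) (volume.restrict Ω) := by
  have hp0 : 0 < p := by linarith
  refine (((integrable_norm_rpow_ofReal hp0 hG).add
    (integrable_norm_rpow_ofReal hp0 hH)).const_mul |β|).mono'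
    ((ha.aestronglyMeasurable_comp hG.aestronglyMeasurable).inner hH.aestronglyMeasurable) ?_
  filter_upwards [ha.abs_inner_le H] with x hx
  calc _ ≤ β * (‖G x‖ ^ (p - 1) * ‖H x‖) := hx _
    _ ≤ |β| * (‖G x‖ ^ (p - 1) * ‖H x‖) := by gcongr; exact le_abs_self β
    _ ≤ |β| * (‖G x‖ ^ p + ‖H x‖ ^ p) := by
      gcongr; exact rpow_sub_one_mul_le hp (norm_nonneg _) (norm_nonneg _)

end StructureConditions

section Reaction

lemma abs_reaction_le (hρR : ∀ᵐ x ∂(volume.restrict Ω), 0 ≤ ρ x ∧ ρ x ≤ R)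
    (hp : 1 < p) (v : EuclideanSpace ℝ (Fin N) → ℝ) :
    ∀ᵐ x ∂(volume.restrict Ω), ∀ t : ℝ,
      |ρ x * (|t| ^ (p - 2) * t) * v x| ≤ R * (‖t‖ ^ (p - 1) * ‖v x‖) := by
  filter_upwards [hρR] with x hx t
  rw [abs_mul, abs_mul, abs_abs_rpow_mul_self hp, abs_of_nonneg hx.1, mul_assoc]
  simp only [Real.norm_eq_abs]
  gcongr
  exact hx.2

lemma abs_integral_reaction_le (hρR : ∀ᵐ x ∂(volume.restrict Ω), 0 ≤ ρ x ∧ ρ x ≤ R)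
    (hp : 1 < p) (hR : 0 ≤ R)
    (hu : MemLp u (ENNReal.ofReal p) (volume.restrict Ω))
    (hv : MemLp v (ENNReal.ofReal p) (volume.restrict Ω))
    (hu1 : eLpNorm u (ENNReal.ofReal p) (volume.restrict Ω) ≤ 1) :
    |∫ x in Ω, ρ x * (|u x| ^ (p - 2) * u x) * v x| ≤
      R * (eLpNorm v (ENNReal.ofReal p) (volume.restrict Ω)).toReal := by
  have h : ‖∫ x in Ω, ρ x * (|u x| ^ (p - 2) * u x) * v x‖ₑ ≤
      ENNReal.ofReal R * eLpNorm v (ENNReal.ofReal p) (volume.restrict Ω) := by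
    calc _ ≤ ∫⁻ x in Ω, ‖ρ x * (|u x| ^ (p - 2) * u x) * v x‖ₑ :=
          enorm_integral_le_lintegral_enorm _
      _ ≤ ∫⁻ x in Ω, ENNReal.ofReal R * (‖u x‖ₑ ^ (p - 1) * ‖v x‖ₑ) := by
          refine lintegral_mono_ae ?_
          filter_upwards [abs_reaction_le hρR hp v] with x hx
          rw [← ofReal_norm, ← ofReal_norm, ← ofReal_norm,
            ENNReal.ofReal_rpow_of_nonneg (norm_nonneg _) (by linarith),
            ← ENNReal.ofReal_mul (by positivity), ← ENNReal.ofReal_mul hR]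
          exact ENNReal.ofReal_le_ofReal (hx (u x))
      _ = ENNReal.ofReal R * ∫⁻ x in Ω, ‖u x‖ₑ ^ (p - 1) * ‖v x‖ₑ :=
          lintegral_const_mul' _ _ ENNReal.ofReal_ne_top
      _ ≤ ENNReal.ofReal R * (1 * eLpNorm v (ENNReal.ofReal p) (volume.restrict Ω)) := by
          gcongr
          refine (lintegral_rpow_mul_le hp hu.aestronglyMeasurable hv.aestronglyMeasurable).trans ?_
          gcongr
          exact ENNReal.rpow_le_one hu1 (by linarith)
      _ = _ := by rw [one_mul]
  have h2 := ENNReal.toReal_mono (ENNReal.mul_ne_top ENNReal.ofReal_ne_top hv.eLpNorm_ne_top) h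
  rwa [toReal_enorm, Real.norm_eq_abs, ENNReal.toReal_mul, ENNReal.toReal_ofReal hR] at h2

end Reaction

/-- A weak solution together with its weak gradient. -/
def IsWeakSolutionPair {N : ℕ} (Ω : Set (EuclideanSpace ℝ (Fin N))) (p : ℝ)
    (a : EuclideanSpace ℝ (Fin N) → EuclideanSpace ℝ (Fin N) → EuclideanSpace ℝ (Fin N))
    (ρ : EuclideanSpace ℝ (Fin N) → ℝ) (l : ℝ) (u : EuclideanSpace ℝ (Fin N) → ℝ)
    (G : EuclideanSpace ℝ (Fin N) → EuclideanSpace ℝ (Fin N)) : Prop :=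
  MemW01p Ω p u G ∧ ∀ v H, MemW01p Ω p v H →
    ∫ x in Ω, (inner ℝ (a x (G x)) (H x) : ℝ) =
      l * ∫ x in Ω, ρ x * (|u x| ^ (p - 2) * u x) * v x

namespace IsWeakSolutionPair

variable {l l₁ l₂ L : ℝ} {u₁ u₂ : EuclideanSpace ℝ (Fin N) → ℝ}
  {G₁ G₂ : EuclideanSpace ℝ (Fin N) → EuclideanSpace ℝ (Fin N)}

/-- Both sides of the equation are homogeneous of degree `p - 1` in `u`, so eigenfunctions can be
normalised without changing `l`. -/
lemma smul [IsFiniteMeasure (volume.restrict Ω)] (ha : StructureConditions Ω p α β c a)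
    (hp : 1 < p) (h : IsWeakSolutionPair Ω p a ρ l u G) {t : ℝ} (ht : 0 < t) :
    IsWeakSolutionPair Ω p a ρ l (fun x => t * u x) (fun x => t • G x) := by
  refine ⟨by simpa using h.1.linearCombination hp.le h.1 t 0, fun v H hv => ?_⟩
  calc ∫ x in Ω, (inner ℝ (a x (t • G x)) (H x) : ℝ)
      = ∫ x in Ω, t ^ (p - 1) * (inner ℝ (a x (G x)) (H x) : ℝ) := by
        refine integral_congr_ae ?_
        filter_upwards [ha.homogeneous] with x hx
        rw [hx _ t ht, real_inner_smul_left]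
    _ = l * ∫ x in Ω, t ^ (p - 1) * (ρ x * (|u x| ^ (p - 2) * u x) * v x) := by
        rw [integral_const_mul, integral_const_mul, h.2 v H hv]; ring
    _ = _ := by
        congr 2 with x
        rw [abs_mul_rpow_mul_self ht]; ring

lemma pos (hN : 1 ≤ N) (hΩ : Bornology.IsBounded Ω) (ha : StructureConditions Ω p α β c a)
    (hα : 0 < α) (hp : 1 < p) (hρR : ∀ᵐ x ∂(volume.restrict Ω), 0 ≤ ρ x ∧ ρ x ≤ R)
    (h : IsWeakSolutionPair Ω p a ρ l u G) (hu : ¬ (u =ᵐ[volume.restrict Ω] fun _ => 0)) :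
    0 < l := by
  by_contra! hl
  refine hu (h.1.ae_eq_zero_of_grad hN hΩ hp.le ?_)
  have hG := h.1.memW1p.memLp_grad
  have h1 : 0 ≤ ∫ x in Ω, ρ x * (|u x| ^ (p - 2) * u x) * u x := by
    refine integral_nonneg_of_ae ?_
    filter_upwards [hρR] with x hx
    have h2 : 0 ≤ u x * u x := mul_self_nonneg _
    have h3 : 0 ≤ |u x| ^ (p - 2) := by positivity
    have := mul_nonneg hx.1 (mul_nonneg h3 h2)
    simp only [Pi.zero_apply]
    linarith
  have h2 : ∫ x in Ω, (inner ℝ (a x (G x)) (G x) : ℝ) ≤ 0 := by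
    rw [h.2 u G h.1]
    exact mul_nonpos_of_nonpos_of_nonneg hl h1
  have h3 : 0 ≤ᵐ[volume.restrict Ω] fun x => (inner ℝ (a x (G x)) (G x) : ℝ) := by
    filter_upwards [ha.coercive] with x hx
    exact le_trans (by positivity) (hx (G x))
  have h4 := (integral_eq_zero_iff_of_nonneg_ae h3 (ha.integrable_inner hp hG hG)).1
    (le_antisymm h2 (integral_nonneg_of_ae h3))
  filter_upwards [h4, ha.coercive] with x hx hx'
  have h5 := hx' (G x)
  rw [hx, Pi.zero_apply] at h5
  by_contra hne
  have h6 : 0 < ‖G x‖ := norm_pos_iff.2 hne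
  have : 0 < α * ‖G x‖ ^ p := by positivity
  linarith

/-- Testing with `u` itself turns the energy into `l ∫ ρ|u|^p`. -/
lemma energy_le (hp : 1 < p)
    (hρR : ∀ᵐ x ∂(volume.restrict Ω), 0 ≤ ρ x ∧ ρ x ≤ R) (hR : 0 ≤ R)
    (h : IsWeakSolutionPair Ω p a ρ l u G)
    (hu : eLpNorm u (ENNReal.ofReal p) (volume.restrict Ω) ≤ 1) (hl : 0 ≤ l) (hlL : l ≤ L) :
    ∫ x in Ω, (inner ℝ (a x (G x)) (G x) : ℝ) ≤ L * R := by
  have hu' := h.1.memW1p.memLp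
  have h1 := abs_integral_reaction_le hρR hp hR hu' hu' hu
  rw [h.2 u G h.1]
  have h2 : (eLpNorm u (ENNReal.ofReal p) (volume.restrict Ω)).toReal ≤ 1 := by
    simpa using ENNReal.toReal_mono ENNReal.one_ne_top hu
  have h3 : R * (eLpNorm u (ENNReal.ofReal p) (volume.restrict Ω)).toReal ≤ R :=
    mul_le_of_le_one_right hR h2
  calc _ ≤ l * R := by gcongr; exact (le_abs_self _).trans (h1.trans h3)
    _ ≤ L * R := by gcongr

lemma eLpNorm_grad_le (ha : StructureConditions Ω p α β c a) (hα : 0 < α) (hp : 1 < p)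
    (hρR : ∀ᵐ x ∂(volume.restrict Ω), 0 ≤ ρ x ∧ ρ x ≤ R) (hR : 0 ≤ R)
    (h : IsWeakSolutionPair Ω p a ρ l u G)
    (hu : eLpNorm u (ENNReal.ofReal p) (volume.restrict Ω) ≤ 1) (hl : 0 ≤ l) (hlL : l ≤ L) :
    eLpNorm G (ENNReal.ofReal p) (volume.restrict Ω) ≤ ENNReal.ofReal (L * R / α) ^ (1 / p) := by
  have hp0 : 0 < p := by linarith
  have hG := h.1.memW1p.memLp_grad
  have hi := ha.integrable_inner hp hG hG
  rw [eLpNorm_ofReal_eq hp0]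
  refine ENNReal.rpow_le_rpow ?_ (by positivity)
  calc ∫⁻ x in Ω, ‖G x‖ₑ ^ p
      ≤ ∫⁻ x in Ω, ENNReal.ofReal ((inner ℝ (a x (G x)) (G x) : ℝ) / α) := by
        refine lintegral_mono_ae ?_
        filter_upwards [ha.coercive] with x hx
        rw [← ofReal_norm, ENNReal.ofReal_rpow_of_nonneg (norm_nonneg _) hp0.le]
        refine ENNReal.ofReal_le_ofReal ?_
        rw [le_div_iff₀ hα, mul_comm]
        exact hx _
    _ = ENNReal.ofReal (∫ x in Ω, (inner ℝ (a x (G x)) (G x) : ℝ) / α) := by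
        refine (ofReal_integral_eq_lintegral_ofReal (hi.div_const α) ?_).symm
        filter_upwards [ha.coercive] with x hx
        exact div_nonneg (le_trans (by positivity) (hx (G x))) hα.le
    _ ≤ _ := by
        rw [integral_div]
        gcongr
        exact h.energy_le hp hρR hR hu hl hlL

/-- Quantitative stability: the gradients of two normalised solutions are close in `L^p` if the
solutions are. -/
lemma eLpNorm_grad_sub_rpow_le [IsFiniteMeasure (volume.restrict Ω)]
    (ha : StructureConditions Ω p α β c a) (hα : 0 < α) (hp : 1 < p)
    (hρR : ∀ᵐ x ∂(volume.restrict Ω), 0 ≤ ρ x ∧ ρ x ≤ R) (hR : 0 ≤ R)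
    (h₁ : IsWeakSolutionPair Ω p a ρ l₁ u₁ G₁) (h₂ : IsWeakSolutionPair Ω p a ρ l₂ u₂ G₂)
    (hu₁ : eLpNorm u₁ (ENNReal.ofReal p) (volume.restrict Ω) ≤ 1)
    (hu₂ : eLpNorm u₂ (ENNReal.ofReal p) (volume.restrict Ω) ≤ 1)
    (hl₁ : 0 ≤ l₁) (hl₂ : 0 ≤ l₂) (hlL₁ : l₁ ≤ L) (hlL₂ : l₂ ≤ L) :
    eLpNorm (G₁ - G₂) (ENNReal.ofReal p) (volume.restrict Ω) ^ p ≤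
      (ENNReal.ofReal (2 * L * R / α) *
        eLpNorm (u₁ - u₂) (ENNReal.ofReal p) (volume.restrict Ω)) ^ (p / max 2 p) *
      ENNReal.ofReal (2 * L * R) ^ (1 - p / max 2 p) := by
  have hp0 : 0 < p := by linarith
  have hγ0 : 0 < max 2 p := lt_of_lt_of_le two_pos (le_max_left _ _)
  have hθ : 0 ≤ p / max 2 p := by positivity
  have hθ1 : p / max 2 p ≤ 1 := by rw [div_le_one hγ0]; exact le_max_right _ _
  have hmG₁ := h₁.1.memW1p.memLp_grad
  have hmG₂ := h₂.1.memW1p.memLp_grad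
  have hmu : MemLp (u₁ - u₂) (ENNReal.ofReal p) (volume.restrict Ω) :=
    h₁.1.memW1p.memLp.sub h₂.1.memW1p.memLp
  have hL : 0 ≤ L := hl₁.trans hlL₁
  have htest : MemW01p Ω p (u₁ - u₂) (G₁ - G₂) := by
    have := h₁.1.linearCombination hp.le h₂.1 1 (-1)
    convert this using 1
    · ext x; simp [sub_eq_add_neg]
    · ext x : 1; simp [sub_eq_add_neg]
  have hmG : MemLp (G₁ - G₂) (ENNReal.ofReal p) (volume.restrict Ω) := hmG₁.sub hmG₂
  set D : EuclideanSpace ℝ (Fin N) → ℝ := fun x =>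
    inner ℝ (a x (G₁ x) - a x (G₂ x)) (G₁ x - G₂ x) with hD
  have hDi : Integrable D (volume.restrict Ω) := by
    refine ((ha.integrable_inner hp hmG₁ hmG).sub (ha.integrable_inner hp hmG₂ hmG)).congr
      (Eventually.of_forall fun x => ?_)
    simp [hD, inner_sub_left]
  have hD0 : 0 ≤ᵐ[volume.restrict Ω] D := by
    filter_upwards [ha.monotone] with x hx
    exact hx _ _
  set S : EuclideanSpace ℝ (Fin N) → ℝ := fun x => Psi a x (G₁ x) (G₂ x) with hS
  have hSi : Integrable S (volume.restrict Ω) :=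
    (ha.integrable_inner hp hmG₁ hmG₁).add (ha.integrable_inner hp hmG₂ hmG₂)
  have hS0 : 0 ≤ᵐ[volume.restrict Ω] S := by
    filter_upwards [ha.coercive] with x hx
    exact add_nonneg (le_trans (by positivity) (hx _)) (le_trans (by positivity) (hx _))
  have hSint : ∫ x in Ω, S x ≤ 2 * L * R := by
    have : ∫ x in Ω, S x = (∫ x in Ω, (inner ℝ (a x (G₁ x)) (G₁ x) : ℝ)) +
        ∫ x in Ω, (inner ℝ (a x (G₂ x)) (G₂ x) : ℝ) :=
      integral_add (ha.integrable_inner hp hmG₁ hmG₁) (ha.integrable_inner hp hmG₂ hmG₂)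
    have e1 := h₁.energy_le hp hρR hR hu₁ hl₁ hlL₁
    have e2 := h₂.energy_le hp hρR hR hu₂ hl₂ hlL₂
    linarith
  set e := (eLpNorm (u₁ - u₂) (ENNReal.ofReal p) (volume.restrict Ω)).toReal with he
  -- Both equations are tested with `u₁ - u₂`. The two right-hand sides are bounded separately, each
  -- by `L * R * e`, so closeness of `l₁` and `l₂` plays no role.
  have hDint : ∫ x in Ω, D x ≤ 2 * L * R * e := by
    have h3 : ∫ x in Ω, D x = (∫ x in Ω, (inner ℝ (a x (G₁ x)) ((G₁ - G₂) x) : ℝ)) -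
        ∫ x in Ω, (inner ℝ (a x (G₂ x)) ((G₁ - G₂) x) : ℝ) := by
      rw [← integral_sub (ha.integrable_inner hp hmG₁ hmG) (ha.integrable_inner hp hmG₂ hmG)]
      congr 1 with x
      simp [hD, inner_sub_left]
    rw [h3, h₁.2 _ _ htest, h₂.2 _ _ htest]
    have e1 := abs_integral_reaction_le hρR hp hR h₁.1.memW1p.memLp hmu hu₁
    have e2 := abs_integral_reaction_le hρR hp hR h₂.1.memW1p.memLp hmu hu₂
    have he0 : 0 ≤ R * e := by positivity
    have f : ∀ {l r : ℝ}, 0 ≤ l → l ≤ L → |r| ≤ R * e → |l * r| ≤ L * (R * e) := by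
      intro l r hl hlL hr
      rw [abs_mul, abs_of_nonneg hl]
      gcongr
    have f1 := f hl₁ hlL₁ e1
    have f2 := f hl₂ hlL₂ e2
    rw [abs_le] at f1 f2
    linarith [f1.2, f2.1]
  have hpt : ∀ᵐ x ∂(volume.restrict Ω), ‖(G₁ - G₂) x‖ₑ ^ p ≤
      ENNReal.ofReal (D x / α) ^ (p / max 2 p) * ENNReal.ofReal (S x) ^ (1 - p / max 2 p) := by
    filter_upwards [hD0, hS0, ha.coercive, ha.strictlyMonotone] with x hDx hSx hx hx'
    have hSx' : 0 ≤ S x := hSx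
    have hDx' : 0 ≤ D x := hDx
    rw [← ofReal_norm, ENNReal.ofReal_rpow_of_nonneg (norm_nonneg _) hp0.le,
      ENNReal.ofReal_rpow_of_nonneg (by positivity) hθ,
      ENNReal.ofReal_rpow_of_nonneg hSx (by linarith), ← ENNReal.ofReal_mul (by positivity)]
    refine ENNReal.ofReal_le_ofReal (rpow_le_of_strict_monotone hp hα (norm_nonneg _) hSx ?_ hDx
      (hx' _ _))
    -- By coercivity, `S x = 0` forces both gradients to vanish at `x`.
    intro h0
    have e1 := hx (G₁ x)
    have e2 := hx (G₂ x)
    have e3 : 0 ≤ ‖G₁ x‖ ^ p := by positivity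
    have e4 : 0 ≤ ‖G₂ x‖ ^ p := by positivity
    have e5 : α * (‖G₁ x‖ ^ p + ‖G₂ x‖ ^ p) ≤ 0 := by
      rw [← h0]; simp only [hS, Psi]; linarith
    have e6 : ‖G₁ x‖ ^ p + ‖G₂ x‖ ^ p ≤ 0 := by
      by_contra! hcon
      have := mul_pos hα hcon
      linarith
    have e7 : ‖G₁ x‖ = 0 := (Real.rpow_eq_zero (norm_nonneg _) hp0.ne').1 (by linarith)
    have e8 : ‖G₂ x‖ = 0 := (Real.rpow_eq_zero (norm_nonneg _) hp0.ne').1 (by linarith)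
    rw [norm_eq_zero] at e7 e8
    simp [e7, e8]
  rw [eLpNorm_ofReal_rpow hp0]
  refine (lintegral_mono_ae hpt).trans ?_
  refine (ENNReal.lintegral_mul_norm_pow_le
    (hDi.div_const α).aemeasurable.ennreal_ofReal hSi.aemeasurable.ennreal_ofReal hθ
    (by linarith) (by ring)).trans ?_
  gcongr
  · rw [← ofReal_integral_eq_lintegral_ofReal (hDi.div_const α)
      (hD0.mono fun x hx => div_nonneg hx hα.le), integral_div,
      ← ENNReal.ofReal_toReal hmu.eLpNorm_ne_top, ← ENNReal.ofReal_mul (by positivity)]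
    refine ENNReal.ofReal_le_ofReal ?_
    rw [div_mul_eq_mul_div]
    gcongr
  · rw [← ofReal_integral_eq_lintegral_ofReal hSi hS0]
    exact ENNReal.ofReal_le_ofReal hSint

end IsWeakSolutionPair
end QuasilinearEigenvalue

/-! ### Compactness of normalised eigenfunctions and closedness of the spectrum. -/

namespace QuasilinearEigenvalue

variable {N : ℕ} {Ω : Set (EuclideanSpace ℝ (Fin N))} {p α β c R L : ℝ}
  {a : EuclideanSpace ℝ (Fin N) → EuclideanSpace ℝ (Fin N) → EuclideanSpace ℝ (Fin N)}
  {ρ : EuclideanSpace ℝ (Fin N) → ℝ}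

lemma exists_normalized_pair [IsFiniteMeasure (volume.restrict Ω)]
    (ha : StructureConditions Ω p α β c a) (hp : 1 < p) {l : ℝ} (hl : l ∈ spectrum Ω p a ρ) :
    ∃ u G, IsWeakSolutionPair Ω p a ρ l u G ∧
      eLpNorm u (ENNReal.ofReal p) (volume.restrict Ω) = 1 := by
  obtain ⟨u, ⟨G, hG⟩, hu⟩ := hl
  set m := eLpNorm u (ENNReal.ofReal p) (volume.restrict Ω) with hm
  have hm0 : m ≠ 0 := fun h0 => hu ((eLpNorm_eq_zero_iff hG.1.memW1p.memLp.aestronglyMeasurable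
    (by simpa using by linarith)).1 h0)
  have hmt : m ≠ ⊤ := hG.1.memW1p.memLp.eLpNorm_ne_top
  have ht : 0 < m.toReal⁻¹ := inv_pos.2 (ENNReal.toReal_pos hm0 hmt)
  refine ⟨_, _, IsWeakSolutionPair.smul ha hp (G := G) hG ht, ?_⟩
  have h1 := eLpNorm_const_smul (m.toReal⁻¹) u (ENNReal.ofReal p) (volume.restrict Ω)
  change eLpNorm (fun x => m.toReal⁻¹ * u x) _ _ = _ at h1
  rw [h1, ← hm, ← ofReal_norm, Real.norm_of_nonneg ht.le,
    ENNReal.ofReal_inv_of_pos (ENNReal.toReal_pos hm0 hmt), ENNReal.ofReal_toReal hmt,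
    ENNReal.inv_mul_cancel hm0 hmt]

lemma tendsto_eLpNorm_pairs {X F : Type*} [MeasurableSpace X] {μ : Measure X}
    [NormedAddCommGroup F] {q : ENNReal} (hq : 1 ≤ q) {f : ℕ → X → F} {g : X → F}
    (hf : ∀ n, AEStronglyMeasurable (f n) μ) (hg : AEStronglyMeasurable g μ)
    (h : Tendsto (fun n => eLpNorm (f n - g) q μ) atTop (𝓝 0)) :
    Tendsto (fun nm : ℕ × ℕ => eLpNorm (f nm.1 - f nm.2) q μ) atTop (𝓝 0) := by
  have h1 := (h.comp tendsto_fst).add (h.comp (tendsto_snd (f := (atTop : Filter ℕ))))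
  rw [add_zero, prod_atTop_atTop_eq] at h1
  refine tendsto_of_tendsto_of_tendsto_of_le_of_le tendsto_const_nhds h1
    (fun _ => zero_le) fun nm => ?_
  refine le_trans (le_of_eq ?_) (eLpNorm_sub_le ((hf nm.1).sub hg) ((hf nm.2).sub hg) hq)
  congr 1
  abel

/-- Along normalised solutions with bounded eigenvalues, `L^p` convergence of the solutions
entails `L^p` convergence of the gradients. -/
lemma exists_tendsto_grad [IsFiniteMeasure (volume.restrict Ω)]
    (ha : StructureConditions Ω p α β c a) (hα : 0 < α) (hp : 1 < p)
    (hρR : ∀ᵐ x ∂(volume.restrict Ω), 0 ≤ ρ x ∧ ρ x ≤ R) (hR : 0 ≤ R)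
    {l : ℕ → ℝ} {U : ℕ → EuclideanSpace ℝ (Fin N) → ℝ}
    {K : ℕ → EuclideanSpace ℝ (Fin N) → EuclideanSpace ℝ (Fin N)}
    (h : ∀ n, IsWeakSolutionPair Ω p a ρ (l n) (U n) (K n))
    (hU : ∀ n, eLpNorm (U n) (ENNReal.ofReal p) (volume.restrict Ω) ≤ 1)
    (hl : ∀ n, 0 ≤ l n) (hlL : ∀ n, l n ≤ L)
    {u : EuclideanSpace ℝ (Fin N) → ℝ} (hu : MemLp u (ENNReal.ofReal p) (volume.restrict Ω))
    (hUu : Tendsto (fun n => eLpNorm (U n - u) (ENNReal.ofReal p) (volume.restrict Ω))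
      atTop (𝓝 0)) :
    ∃ G, MemLp G (ENNReal.ofReal p) (volume.restrict Ω) ∧
      Tendsto (fun n => eLpNorm (K n - G) (ENNReal.ofReal p) (volume.restrict Ω))
        atTop (𝓝 0) := by
  have hp0 : 0 < p := by linarith
  have hp1 : 1 ≤ ENNReal.ofReal p := by simpa using hp.le
  have hγ0 : 0 < max 2 p := lt_of_lt_of_le two_pos (le_max_left _ _)
  have hθ1 : p / max 2 p ≤ 1 := by rw [div_le_one hγ0]; exact le_max_right _ _
  have hθ : 0 < p / max 2 p := by positivity
  refine exists_tendsto_eLpNorm_of_cauchy hp1 (fun n => (h n).1.memW1p.memLp_grad) ?_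
  have h1 := tendsto_eLpNorm_pairs hp1 (fun n => (h n).1.memW1p.memLp.aestronglyMeasurable)
    hu.aestronglyMeasurable hUu
  have h2 := ENNReal.Tendsto.const_mul (a := ENNReal.ofReal (2 * L * R / α)) h1
    (Or.inr ENNReal.ofReal_ne_top)
  have h3 := ((ENNReal.continuous_rpow_const (y := p / max 2 p)).tendsto _).comp h2
  rw [mul_zero, ENNReal.zero_rpow_of_pos hθ] at h3
  have h4 := ENNReal.Tendsto.mul_const
    (b := ENNReal.ofReal (2 * L * R) ^ (1 - p / max 2 p)) h3
    (Or.inr (ENNReal.rpow_ne_top_of_nonneg (by linarith) ENNReal.ofReal_ne_top))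
  have h5 := ((ENNReal.continuous_rpow_const (y := 1 / p)).tendsto _).comp h4
  rw [zero_mul, ENNReal.zero_rpow_of_pos (by positivity)] at h5
  refine tendsto_of_tendsto_of_tendsto_of_le_of_le tendsto_const_nhds h5
    (fun _ => zero_le) fun nm => ?_
  simp only [Function.comp_apply, one_div]
  rw [ENNReal.le_rpow_inv_iff hp0]
  exact IsWeakSolutionPair.eLpNorm_grad_sub_rpow_le ha hα hp hρR hR (h nm.1) (h nm.2)
    (hU _) (hU _) (hl _) (hl _) (hlL _) (hlL _)

lemma exists_subseq_tendsto_ae {X F : Type*} [MeasurableSpace X] {μ : Measure X}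
    [NormedAddCommGroup F] {q : ENNReal} (hq : q ≠ 0) {f : ℕ → X → F} {g : X → F}
    (hf : ∀ n, AEStronglyMeasurable (f n) μ) (hg : AEStronglyMeasurable g μ)
    (h : Tendsto (fun n => eLpNorm (f n - g) q μ) atTop (𝓝 0)) :
    ∃ s : ℕ → ℕ, StrictMono s ∧ ∀ᵐ x ∂μ, Tendsto (fun n => f (s n) x) atTop (𝓝 (g x)) :=
  (tendstoInMeasure_of_tendsto_eLpNorm hq hf hg h).exists_seq_tendsto_ae

/-- The weak formulation is stable under strong convergence in `W^{1,p}`. -/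
lemma IsWeakSolutionPair.of_tendsto [IsFiniteMeasure (volume.restrict Ω)]
    (ha : StructureConditions Ω p α β c a) (hp : 1 < p)
    (hρ : AEMeasurable ρ (volume.restrict Ω))
    (hρR : ∀ᵐ x ∂(volume.restrict Ω), 0 ≤ ρ x ∧ ρ x ≤ R)
    {l : ℕ → ℝ} {U : ℕ → EuclideanSpace ℝ (Fin N) → ℝ}
    {K : ℕ → EuclideanSpace ℝ (Fin N) → EuclideanSpace ℝ (Fin N)}
    (h : ∀ n, IsWeakSolutionPair Ω p a ρ (l n) (U n) (K n))
    {l' : ℝ} (hl : Tendsto l atTop (𝓝 l'))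
    {u : EuclideanSpace ℝ (Fin N) → ℝ} (hu : MemLp u (ENNReal.ofReal p) (volume.restrict Ω))
    (hUu : Tendsto (fun n => eLpNorm (U n - u) (ENNReal.ofReal p) (volume.restrict Ω))
      atTop (𝓝 0))
    {G : EuclideanSpace ℝ (Fin N) → EuclideanSpace ℝ (Fin N)}
    (hG : MemLp G (ENNReal.ofReal p) (volume.restrict Ω))
    (hKG : Tendsto (fun n => eLpNorm (K n - G) (ENNReal.ofReal p) (volume.restrict Ω))
      atTop (𝓝 0)) : IsWeakSolutionPair Ω p a ρ l' u G := by
  have hp0 : 0 < p := by linarith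
  have hq : ENNReal.ofReal p ≠ 0 := by simpa using hp0
  refine ⟨MemW01p.of_tendsto hp.le (fun n => (h n).1) hu hG hUu hKG, fun v H hv => ?_⟩
  have hUm := fun n => (h n).1.memW1p.memLp
  have hKm := fun n => (h n).1.memW1p.memLp_grad
  -- A.e. convergence of functions and gradients along one common subsequence suffices, since only
  -- the equation of the limit is sought.
  obtain ⟨s, hs, hsu⟩ := exists_subseq_tendsto_ae hq (fun n => (hUm n).aestronglyMeasurable)
    hu.aestronglyMeasurable hUu
  obtain ⟨t, ht, htG⟩ := exists_subseq_tendsto_ae hq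
    (fun n => (hKm (s n)).aestronglyMeasurable) hG.aestronglyMeasurable
    (hKG.comp hs.tendsto_atTop)
  have hst : Tendsto (fun n => s (t n)) atTop atTop := hs.tendsto_atTop.comp ht.tendsto_atTop
  have hvm := hv.memW1p.memLp
  have hHm := hv.memW1p.memLp_grad
  have h1 : Tendsto (fun n => ∫ x in Ω, (inner ℝ (a x (K (s (t n)) x)) (H x) : ℝ)) atTop
      (𝓝 (∫ x in Ω, (inner ℝ (a x (G x)) (H x) : ℝ))) := by
    refine tendsto_integral_superposition hp (b := fun x ξ => (inner ℝ (a x ξ) (H x) : ℝ))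
      (w := H) hHm ?_ β (ha.abs_inner_le H) hG (fun n => hKm _) (fun n => ?_) ?_
      (hKG.comp hst) htG
    · filter_upwards [ha.continuous] with x hx
      exact hx.inner continuous_const
    · exact (ha.aestronglyMeasurable_comp (hKm _).aestronglyMeasurable).inner
        hHm.aestronglyMeasurable
    · exact (ha.aestronglyMeasurable_comp hG.aestronglyMeasurable).inner hHm.aestronglyMeasurable
  have hmeas : ∀ w : EuclideanSpace ℝ (Fin N) → ℝ,
      MemLp w (ENNReal.ofReal p) (volume.restrict Ω) →
      AEStronglyMeasurable (fun x => ρ x * (|w x| ^ (p - 2) * w x) * v x)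
        (volume.restrict Ω) := fun w hw =>
    (hρ.aestronglyMeasurable.mul ((continuous_abs_rpow_mul_self hp).comp_aestronglyMeasurable
      hw.aestronglyMeasurable)).mul hvm.aestronglyMeasurable
  have h2 : Tendsto (fun n => ∫ x in Ω, ρ x * (|U (s (t n)) x| ^ (p - 2) * U (s (t n)) x) * v x)
      atTop (𝓝 (∫ x in Ω, ρ x * (|u x| ^ (p - 2) * u x) * v x)) := by
    refine tendsto_integral_superposition hp
      (b := fun x (r : ℝ) => ρ x * (|r| ^ (p - 2) * r) * v x)
      (w := v) hvm ?_ R (abs_reaction_le hρR hp v) hu (fun n => hUm _) (fun n => hmeas _ (hUm _))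
      (hmeas _ hu) (hUu.comp hst) ?_
    · exact Eventually.of_forall fun x =>
        (continuous_const.mul (continuous_abs_rpow_mul_self hp)).mul continuous_const
    · filter_upwards [hsu] with x hx
      exact hx.comp ht.tendsto_atTop
  exact tendsto_nhds_unique (h1.congr fun n => (h _).2 v H hv) ((hl.comp hst).mul h2)

lemma isClosed_spectrum (hN : 1 ≤ N) (hΩ : Bornology.IsBounded Ω)
    (ha : StructureConditions Ω p α β c a) (hα : 0 < α) (hp : 1 < p)
    (hρ : AEMeasurable ρ (volume.restrict Ω))
    (hρR : ∀ᵐ x ∂(volume.restrict Ω), 0 ≤ ρ x ∧ ρ x ≤ R) (hR : 0 ≤ R)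
    (hpos : spectrum Ω p a ρ ⊆ Set.Ioi 0) : IsClosed (spectrum Ω p a ρ) := by
  have : IsFiniteMeasure (volume.restrict Ω) :=
    ⟨by rw [Measure.restrict_apply_univ]; exact hΩ.measure_lt_top⟩
  have hp0 : 0 < p := by linarith
  have hp1 : 1 ≤ ENNReal.ofReal p := by simpa using hp.le
  refine IsSeqClosed.isClosed fun l l' hl hll => ?_
  obtain ⟨L, hL⟩ := hll.bddAbove_range
  have hlL : ∀ n, l n ≤ L := fun n => hL ⟨n, rfl⟩
  have hl0 : ∀ n, 0 ≤ l n := fun n => le_of_lt (hpos (hl n))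
  choose U K hUK hU1 using fun n => exists_normalized_pair ha hp (hl n)
  obtain ⟨s, hs, u, hu, hUu⟩ := MemW01p.exists_subseq_tendsto hN hp.le (fun n => (hUK n).1)
    (M := 1 + ENNReal.ofReal (L * R / α) ^ (1 / p))
    (ENNReal.add_ne_top.2 ⟨ENNReal.one_ne_top,
      ENNReal.rpow_ne_top_of_nonneg (by positivity) ENNReal.ofReal_ne_top⟩)
    (fun n => (hU1 n).le.trans le_self_add)
    (fun n => ((hUK n).eLpNorm_grad_le ha hα hp hρR hR (hU1 n).le (hl0 n) (hlL n)).trans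
      le_add_self)
  obtain ⟨G, hG, hKG⟩ := exists_tendsto_grad ha hα hp hρR hR (fun n => hUK (s n))
    (fun n => (hU1 _).le) (fun n => hl0 _) (fun n => hlL _) hu hUu
  have hlim := IsWeakSolutionPair.of_tendsto ha hp hρ hρR (fun n => hUK (s n))
    (hll.comp hs.tendsto_atTop) hu hUu hG hKG
  refine ⟨u, ⟨G, hlim⟩, fun h0 => ?_⟩
  -- If `u` vanished, the distances to `u` would all equal the norm 1 of `U (s n)` and could not
  -- tend to 0.
  have h1 : ∀ n, eLpNorm (U (s n) - u) (ENNReal.ofReal p) (volume.restrict Ω) = 1 := fun n => by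
    rw [← hU1 (s n)]
    refine eLpNorm_congr_ae ?_
    filter_upwards [h0] with x hx
    simp [hx]
  simp_rw [h1] at hUu
  exact one_ne_zero (tendsto_nhds_unique tendsto_const_nhds hUu)

end QuasilinearEigenvalue

theorem proposition4p1 (N : ℕ) (hN : 1 ≤ N) (Ω : Set (EuclideanSpace ℝ (Fin N)))
    (hΩ_open : IsOpen Ω) (hΩ_bounded : Bornology.IsBounded Ω)
    (p : ℝ) (hp : 1 < p) (α β c : ℝ) (hα : 0 < α)
    (a : EuclideanSpace ℝ (Fin N) → EuclideanSpace ℝ (Fin N) → EuclideanSpace ℝ (Fin N))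
    (ha : QuasilinearEigenvalue.StructureConditions Ω p α β c a)
    (ρ : EuclideanSpace ℝ (Fin N) → ℝ) (hρ : AEMeasurable ρ (volume.restrict Ω))
    (ρmin ρmax : ℝ) (hρmin : 0 < ρmin)
    (hρ_bounds : ∀ᵐ x ∂(volume.restrict Ω), ρmin ≤ ρ x ∧ ρ x ≤ ρmax) :
    IsClosed (QuasilinearEigenvalue.spectrum Ω p a ρ) ∧
      QuasilinearEigenvalue.spectrum Ω p a ρ ⊆ Set.Ioi 0 := by
  -- For empty `Ω` the bounds on `ρ` are vacuous and `ρmax` may be negative; its absolute value is a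
  -- nonnegative bound in every case.
  have hρR : ∀ᵐ x ∂(volume.restrict Ω), 0 ≤ ρ x ∧ ρ x ≤ |ρmax| := by
    filter_upwards [hρ_bounds] with x hx
    exact ⟨hρmin.le.trans hx.1, hx.2.trans (le_abs_self _)⟩
  have hpos : QuasilinearEigenvalue.spectrum Ω p a ρ ⊆ Set.Ioi 0 := by
    rintro l ⟨u, ⟨G, hG⟩, hu⟩
    exact QuasilinearEigenvalue.IsWeakSolutionPair.pos hN hΩ_bounded ha hα hp hρR
      (u := u) (G := G) hG hu
  exact ⟨QuasilinearEigenvalue.isClosed_spectrum hN hΩ_bounded ha hα hp hρ hρR (abs_nonneg _)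
    hpos, hpos⟩
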